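/- Let $(G,H,t,m)$ be a Lie crossed module: $G,H$ are finite-dimensional real Lie groups with Lie algebras $\mathfrak g,\mathfrak h$, $t:H\to G$ is a Lie group homomorphism and $m:G\to\mathrm{Aut}(H)$ is an action by automorphisms such that $(a,A)\mapsto m(a)(A)$ is smooth, $t(m(a)(A))=a\,t(A)\,a^{-1}$ and $m(t(A))(B)=ABA^{-1}$. Let $\dot t:\mathfrak h\to\mathfrak g$ and $\dot m(a):\mathfrak h\to\mathfrak h$ be the differentials of $t$ and $m(a)$ at $1_H$, and let $\widehat m(x)(Y)$ be the derivative of $a\mapsto\dot m(a)(Y)$ at $1_G$ in the direction $x$, for $x\in\mathfrak g$, $Y\in\mathfrak h$. A $(G,H)$-cocycle is a triple of smooth maps $f(x',x;y)\in G$, $g(x;y',y)\in G$, $W(x',x;y',y)\in H$ of real variables such that for all arguments $$t(W(x',x;y',y))=g(x;y',y)^{-1}f(x',x;y')^{-1}g(x';y',y)f(x',x;y),$$ $$f(x'',x;y)=f(x'',x';y)f(x',x;y),\qquad g(x;y'',y)=g(x;y'',y')g(x;y',y),$$ $$W(x'',x;y',y)=W(x',x;y',y)\,m(f(x',x;y)^{-1})(W(x'',x';y',y)),$$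 $$W(x',x;y'',y)=m(g(x;y',y)^{-1})(W(x',x;y'',y'))\,W(x',x;y',y).$$ Its associated forms $a=a_{f,g,W}\in\Omega^1(\mathbb R^2,\mathfrak g)$, $B=B_{f,g,W}\in\Omega^2(\mathbb R^2,\mathfrak h)$ are given by $$a_x(x,y)=-\partial_{x'}f(x',x;y)f(x',x;y)^{-1}\big|_{x'=x},\qquad a_y(x,y)=-\partial_{y'}g(x;y',y)g(x;y',y)^{-1}\big|_{y'=y},$$ $$B_{xy}(x,y)=-\partial_{x'}\big(\partial_{y'}W(x',x;y',y)W(x',x;y',y)^{-1}\big)\big|_{x'=x,\,y'=y}.$$ A $1$-gauge transformation of $(f,g,W)$ is a triple of smooth maps $\kappa(x;y)\in G$, $\Psi(x',x;y)\in H$, $\Phi(x;y',y)\in H$ such that $$\Psi(x'',x;y)=\Psi(x',x;y)\,m(f(x',x;y)^{-1})(\Psi(x'',x';y)),\qquad \Phi(x;y'',y)=\Phi(x;y',y)\,m(g(x;y',y)^{-1})(\Phi(x;y'',y')).$$ It transforms $(f,g,W)$ into the $(G,H)$-cocycle $(f^\ast,g^\ast,W^\ast)$ with $$f^\ast(x',x;y)=\kappa(x';y)f(x',x;y)t(\Psi(x',x;y))^{-1}\kappa(x;y)^{-1},\qquad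 g^\ast(x;y',y)=\kappa(x;y')g(x;y',y)t(\Phi(x;y',y))^{-1}\kappa(x;y)^{-1},$$ $$W^\ast(x',x;y',y)=m(\kappa(x;y))\Big(\Phi(x;y',y)\,m(g(x;y',y)^{-1})(\Psi(x',x;y'))\,W(x',x;y',y)\,m(f(x',x;y)^{-1})(\Phi(x';y',y))^{-1}\,\Psi(x',x;y)^{-1}\Big).$$ Put $\varkappa(x,y)=\kappa(x;y)$ and let $\Gamma\in\Omega^1(\mathbb R^2,\mathfrak h)$ be given by $$\Gamma_x(x,y)=-\dot m(\kappa(x;y))\big(\Psi(x',x;y)^{-1}\partial_{x'}\Psi(x',x;y)\big|_{x'=x}\big),\qquad \Gamma_y(x,y)=-\dot m(\kappa(x;y))\big(\Phi(x;y',y)^{-1}\partial_{y'}\Phi(x;y',y)\big|_{y'=y}\big).$$ Then for every $(G,H)$-cocycle $(f,g,W)$ and every $1$-gauge transformation $(\kappa,\Psi,\Phi)$ of it, the pair $(a^\ast,B^\ast)$ associated with $(f^\ast,g^\ast,W^\ast)$ is a connection doublet, i.e. it consists of smooth forms with $da^\ast+\tfrac12[a^\ast,a^\ast]-\dot t(B^\ast)=0$,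 and $$a^\ast=\mathrm{Ad}\,\varkappa(a)-d\varkappa\,\varkappa^{-1}-\dot t(\Gamma),$$ $$B^\ast=\dot m(\varkappa)(B)-d\Gamma-\tfrac12[\Gamma,\Gamma]-\widehat m\big(\mathrm{Ad}\,\varkappa(a)-d\varkappa\,\varkappa^{-1}-\dot t(\Gamma),\,\Gamma\big).$$ Here $[\alpha,\beta]$ and $\widehat m(\alpha,\beta)$ of two $1$-forms are the wedge products along the brackets of $\mathfrak g$, $\mathfrak h$ and along $\widehat m$, that is, $(u,v)\mapsto[\alpha(u),\beta(v)]-[\alpha(v),\beta(u)]$ and $(u,v)\mapsto\widehat m(\alpha(u))(\beta(v))-\widehat m(\alpha(v))(\beta(u))$. -/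

import Mathlib

open scoped Manifold ContDiff

noncomputable section

namespace HigherGauge

/-! ### Lie groups

A (real, finite dimensional, smooth) Lie group `G` is modelled on a vector space `𝔤`, which in
Mathlib is also, definitionally, the tangent space of `G` at `1`, i.e. the Lie algebra of `G`. -/

section LieGroup

variable {𝔤 G : Type*} [NormedAddCommGroup 𝔤] [NormedSpace ℝ 𝔤]
  [TopologicalSpace G] [ChartedSpace 𝔤 G] [Group G]

variable (G) in
/-- The Lie bracket of the Lie algebra `𝔤 = T₁G` of the Lie group `G`. -/
def bracket (x y : 𝔤) : 𝔤 :=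
  Bracket.bracket (L := GroupLieAlgebra 𝓘(ℝ, 𝔤) G) (M := GroupLieAlgebra 𝓘(ℝ, 𝔤) G) x y

/-- The adjoint action `Ad a` of `a : G` on `𝔤`: the differential at `1` of conjugation. -/
def Ad (a : G) : 𝔤 →L[ℝ] 𝔤 :=
  mfderiv 𝓘(ℝ, 𝔤) 𝓘(ℝ, 𝔤) (fun b : G => a * b * a⁻¹) 1

variable {V : Type*} [NormedAddCommGroup V] [NormedSpace ℝ V]

/-- The right logarithmic differential `dF F⁻¹` at `p` of a map `F` from a vector space to `G`:
the differential at `p` of `q ↦ F q (F p)⁻¹`, which takes the value `1` at `p`. -/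
def rightLog (F : V → G) (p : V) : V →L[ℝ] 𝔤 :=
  mfderiv 𝓘(ℝ, V) 𝓘(ℝ, 𝔤) (fun q => F q * (F p)⁻¹) p

/-- The left logarithmic differential `F⁻¹ dF` at `p` of a map `F` from a vector space to `G`:
the differential at `p` of `q ↦ (F p)⁻¹ F q`, which takes the value `1` at `p`. -/
def leftLog (F : V → G) (p : V) : V →L[ℝ] 𝔤 :=
  mfderiv 𝓘(ℝ, V) 𝓘(ℝ, 𝔤) (fun q => (F p)⁻¹ * F q) p

end LieGroup

/-! ### Vector valued differential forms on the plane -/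

section Forms

variable {V W U : Type*} [NormedAddCommGroup V] [NormedSpace ℝ V]
  [NormedAddCommGroup W] [NormedSpace ℝ W] [NormedAddCommGroup U] [NormedSpace ℝ U]

/-- `V`-valued differential `k`-forms on `ℝ²` (smoothness is required separately). -/
abbrev Form (k : ℕ) (V : Type*) [NormedAddCommGroup V] [NormedSpace ℝ V] : Type _ :=
  ℝ × ℝ → (ℝ × ℝ) [⋀^Fin k]→L[ℝ] V

/-- The `1`-form whose value at `p` is the linear map `α p`. -/
def toForm (α : ℝ × ℝ → (ℝ × ℝ →L[ℝ] V)) : Form 1 V :=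
  fun p => ContinuousAlternatingMap.ofSubsingleton ℝ (ℝ × ℝ) V (0 : Fin 1) (α p)

/-- The `1`-form `αx dx + αy dy`. -/
def oneForm (αx αy : ℝ × ℝ → V) : Form 1 V :=
  toForm fun p => (ContinuousLinearMap.fst ℝ ℝ ℝ).smulRight (αx p) +
    (ContinuousLinearMap.snd ℝ ℝ ℝ).smulRight (αy p)

/-- The scalar `2`-form `dx ∧ dy`, i.e. the alternatization of `dx ⊗ dy`. -/
def dxdy : (ℝ × ℝ) [⋀^Fin 2]→L[ℝ] ℝ :=
  ContinuousMultilinearMap.alternatization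
    ((ContinuousMultilinearMap.mkPiAlgebra ℝ (Fin 2) ℝ).compContinuousLinearMap
      ![ContinuousLinearMap.fst ℝ ℝ ℝ, ContinuousLinearMap.snd ℝ ℝ ℝ])

/-- The `2`-form `βxy dx ∧ dy`. -/
def twoForm (βxy : ℝ × ℝ → V) : Form 2 V :=
  fun p => (ContinuousLinearMap.toSpanSingleton ℝ (βxy p)).compContinuousAlternatingMap dxdy

/-- The action on a form of a field of linear maps on its values. -/
def mapForm {k : ℕ} (L : ℝ × ℝ → (V →L[ℝ] W)) (η : Form k V) : Form k W :=
  fun p => (L p).compContinuousAlternatingMap (η p)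

/-- The wedge product `b(α ∧ β)` of two `1`-forms along a pairing `b` of their values; for bilinear
`b` this is the `2`-form `(u, v) ↦ b (α u) (β v) - b (α v) (β u)`. -/
def wedge (b : V → W → U) (α : Form 1 V) (β : Form 1 W) : Form 2 U :=
  twoForm fun p =>
    b (α p ![(1, 0)]) (β p ![(0, 1)]) - b (α p ![(0, 1)]) (β p ![(1, 0)])

theorem oneForm_apply (αx αy : ℝ × ℝ → V) (p u : ℝ × ℝ) :
    oneForm αx αy p ![u] = u.1 • αx p + u.2 • αy p := by
  simp [oneForm, toForm]

theorem twoForm_apply (βxy : ℝ × ℝ → V) (p u v : ℝ × ℝ) :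
    twoForm βxy p ![u, v] = (u.1 * v.2 - v.1 * u.2) • βxy p := by
  have h : dxdy ![u, v] = u.1 * v.2 - v.1 * u.2 := by
    have h2 : (Finset.univ : Finset (Equiv.Perm (Fin 2))) = {1, Equiv.swap 0 1} := by decide
    rw [dxdy, ContinuousMultilinearMap.alternatization_apply_apply, h2,
      Finset.sum_pair (by decide)]
    simp [Fin.prod_univ_two]
    ring
  simp [twoForm, h]

end Forms

/-! ### Lie crossed modules -/

/-- A Lie crossed module `(G, H, t, m)`: Lie groups `G`, `H` with a Lie group homomorphism
`t : H → G` and a smooth action `m` of `G` on `H` by automorphisms, subject to equivariance of `t`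
and to the Peiffer identity. -/
structure LieCrossedModule (𝔤 𝔥 G H : Type*)
    [NormedAddCommGroup 𝔤] [NormedSpace ℝ 𝔤] [NormedAddCommGroup 𝔥] [NormedSpace ℝ 𝔥]
    [TopologicalSpace G] [ChartedSpace 𝔤 G] [Group G]
    [TopologicalSpace H] [ChartedSpace 𝔥 H] [Group H] where
  t : H →* G
  m : G →* MulAut H
  contMDiff_t : ContMDiff 𝓘(ℝ, 𝔥) 𝓘(ℝ, 𝔤) ∞ t
  contMDiff_m : ContMDiff (𝓘(ℝ, 𝔤).prod 𝓘(ℝ, 𝔥)) 𝓘(ℝ, 𝔥) ∞ (fun p : G × H => m p.1 p.2)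
  t_m : ∀ (a : G) (A : H), t (m a A) = a * t A * a⁻¹
  m_t : ∀ A B : H, m (t A) B = A * B * A⁻¹

variable {𝔤 𝔥 G H : Type*}
  [NormedAddCommGroup 𝔤] [NormedSpace ℝ 𝔤] [NormedAddCommGroup 𝔥] [NormedSpace ℝ 𝔥]
  [TopologicalSpace G] [ChartedSpace 𝔤 G] [Group G]
  [TopologicalSpace H] [ChartedSpace 𝔥 H] [Group H]

namespace LieCrossedModule

variable (X : LieCrossedModule 𝔤 𝔥 G H)

/-- `ṫ : 𝔥 → 𝔤`, the differential of `t` at `1`. -/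
def tdot : 𝔥 →L[ℝ] 𝔤 := mfderiv 𝓘(ℝ, 𝔥) 𝓘(ℝ, 𝔤) X.t 1

/-- `ṁ(a) : 𝔥 → 𝔥`, the differential of the automorphism `m a` at `1`. -/
def mdot (a : G) : 𝔥 →L[ℝ] 𝔥 := mfderiv 𝓘(ℝ, 𝔥) 𝓘(ℝ, 𝔥) (X.m a) 1

/-- `m̂(x)(Y)`, the differential at `a = 1` of `a ↦ ṁ(a)(Y)` in the direction `x`. -/
def mhat (x : 𝔤) (Y : 𝔥) : 𝔥 := mfderiv 𝓘(ℝ, 𝔤) 𝓘(ℝ, 𝔥) (fun a : G => X.mdot a Y) 1 x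

end LieCrossedModule

/-! ### Cocycles and integral 1-gauge transformations -/

variable (X : LieCrossedModule 𝔤 𝔥 G H)

/-- A `(G, H)`-cocycle `(f, g, W)`; here `f x' x y`, `g x y' y`, `W x' x y' y` stand for
`f(x', x; y)`, `g(x; y', y)`, `W(x', x; y', y)`. -/
structure Cocycle where
  f : ℝ → ℝ → ℝ → G
  g : ℝ → ℝ → ℝ → G
  W : ℝ → ℝ → ℝ → ℝ → H
  contMDiff_f : ContMDiff 𝓘(ℝ, ℝ × ℝ × ℝ) 𝓘(ℝ, 𝔤) ∞
    (fun p : ℝ × ℝ × ℝ => f p.1 p.2.1 p.2.2)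
  contMDiff_g : ContMDiff 𝓘(ℝ, ℝ × ℝ × ℝ) 𝓘(ℝ, 𝔤) ∞
    (fun p : ℝ × ℝ × ℝ => g p.1 p.2.1 p.2.2)
  contMDiff_W : ContMDiff 𝓘(ℝ, ℝ × ℝ × ℝ × ℝ) 𝓘(ℝ, 𝔥) ∞
    (fun p : ℝ × ℝ × ℝ × ℝ => W p.1 p.2.1 p.2.2.1 p.2.2.2)
  target : ∀ x' x y' y,
    X.t (W x' x y' y) = (g x y' y)⁻¹ * (f x' x y')⁻¹ * g x' y' y * f x' x y
  f_comp : ∀ x'' x' x y, f x'' x y = f x'' x' y * f x' x y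
  g_comp : ∀ x y'' y' y, g x y'' y = g x y'' y' * g x y' y
  W_comp_x : ∀ x'' x' x y' y,
    W x'' x y' y = W x' x y' y * X.m (f x' x y)⁻¹ (W x'' x' y' y)
  W_comp_y : ∀ x' x y'' y' y,
    W x' x y'' y = X.m (g x y' y)⁻¹ (W x' x y'' y') * W x' x y' y

variable {X}

/-- An `(f, g, W)`-1-gauge transformation `(κ, Ψ, Φ)`; here `κ x y`, `Ψ x' x y`, `Φ x y' y` stand
for `κ(x; y)`, `Ψ(x', x; y)`, `Φ(x; y', y)`. -/
structure GaugeTransformation (C : Cocycle X) where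
  κ : ℝ → ℝ → G
  Ψ : ℝ → ℝ → ℝ → H
  Φ : ℝ → ℝ → ℝ → H
  contMDiff_κ : ContMDiff 𝓘(ℝ, ℝ × ℝ) 𝓘(ℝ, 𝔤) ∞ (fun p : ℝ × ℝ => κ p.1 p.2)
  contMDiff_Ψ : ContMDiff 𝓘(ℝ, ℝ × ℝ × ℝ) 𝓘(ℝ, 𝔥) ∞
    (fun p : ℝ × ℝ × ℝ => Ψ p.1 p.2.1 p.2.2)
  contMDiff_Φ : ContMDiff 𝓘(ℝ, ℝ × ℝ × ℝ) 𝓘(ℝ, 𝔥) ∞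
    (fun p : ℝ × ℝ × ℝ => Φ p.1 p.2.1 p.2.2)
  Ψ_comp : ∀ x'' x' x y, Ψ x'' x y = Ψ x' x y * X.m (C.f x' x y)⁻¹ (Ψ x'' x' y)
  Φ_comp : ∀ x y'' y' y, Φ x y'' y = Φ x y' y * X.m (C.g x y' y)⁻¹ (Φ x y'' y')

namespace Cocycle

/-! The connection doublet `(a, B)` associated with a cocycle. -/

variable (C : Cocycle X)

/-- The `1`-form `a = aₓ dx + a_y dy` with `aₓ(x, y) = -∂_{x'} f(x', x; y) f(x', x; y)⁻¹` at
`x' = x` and `a_y(x, y) = -∂_{y'} g(x; y', y) g(x; y', y)⁻¹` at `y' = y`. -/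
def a : Form 1 𝔤 :=
  oneForm
    (fun p => -rightLog (fun x' => C.f x' p.1 p.2) p.1 1)
    (fun p => -rightLog (fun y' => C.g p.1 y' p.2) p.2 1)

/-- The `2`-form `B = B_{xy} dx ∧ dy` with
`B_{xy}(x, y) = -∂_{x'} (∂_{y'} W(x', x; y', y) W(x', x; y', y)⁻¹)` at `x' = x`, `y' = y`. -/
def B : Form 2 𝔥 :=
  twoForm fun p =>
    -deriv (fun x' => rightLog (fun y' => C.W x' p.1 y' p.2) p.2 1) p.1

end Cocycle

variable (X) in
/-- `(a, B)` is a `(G, H)`-connection doublet: `a` and `B` are smooth forms satisfying the zero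
fake curvature condition `da + ½[a, a] - ṫ(B) = 0`. -/
structure IsConnectionDoublet (a : Form 1 𝔤) (B : Form 2 𝔥) : Prop where
  contDiff_a : ContDiff ℝ ∞ a
  contDiff_B : ContDiff ℝ ∞ B
  fakeFlat : extDeriv a + (1 / 2 : ℝ) • wedge (bracket G) a a - mapForm (fun _ => X.tdot) B = 0

namespace GaugeTransformation

variable {C : Cocycle X} (T : GaugeTransformation C)

/-! The differential 1-gauge transformation `(ϰ, Γ)` corresponding to an integral one. -/

/-- The map `ϰ(x, y) = κ(x; y)`. -/
def varkappa (p : ℝ × ℝ) : G := T.κ p.1 p.2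

/-- The `1`-form `Γ = Γₓ dx + Γ_y dy` with
`Γₓ(x, y) = -ṁ(κ(x; y))(Ψ(x', x; y)⁻¹ ∂_{x'} Ψ(x', x; y))` at `x' = x` and
`Γ_y(x, y) = -ṁ(κ(x; y))(Φ(x; y', y)⁻¹ ∂_{y'} Φ(x; y', y))` at `y' = y`. -/
def Γ : Form 1 𝔥 :=
  oneForm
    (fun p => -X.mdot (T.κ p.1 p.2) (leftLog (fun x' => T.Ψ x' p.1 p.2) p.1 1))
    (fun p => -X.mdot (T.κ p.1 p.2) (leftLog (fun y' => T.Φ p.1 y' p.2) p.2 1))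

section Helpers

theorem contMDiff_pair {V M : Type*} [NormedAddCommGroup V] [NormedSpace ℝ V]
    {E : Type*} [NormedAddCommGroup E] [NormedSpace ℝ E] [TopologicalSpace M] [ChartedSpace E M]
    {F : ℝ → ℝ → M} (hF : ContMDiff 𝓘(ℝ, ℝ × ℝ) 𝓘(ℝ, E) ∞ (fun p : ℝ × ℝ => F p.1 p.2))
    {u v : V → ℝ} (hu : ContDiff ℝ ∞ u) (hv : ContDiff ℝ ∞ v) :
    ContMDiff 𝓘(ℝ, V) 𝓘(ℝ, E) ∞ (fun p => F (u p) (v p)) :=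
  hF.comp (hu.prodMk hv).contMDiff

theorem contMDiff_triple {V M : Type*} [NormedAddCommGroup V] [NormedSpace ℝ V]
    {E : Type*} [NormedAddCommGroup E] [NormedSpace ℝ E] [TopologicalSpace M] [ChartedSpace E M]
    {F : ℝ → ℝ → ℝ → M}
    (hF : ContMDiff 𝓘(ℝ, ℝ × ℝ × ℝ) 𝓘(ℝ, E) ∞ (fun p : ℝ × ℝ × ℝ => F p.1 p.2.1 p.2.2))
    {u v w : V → ℝ} (hu : ContDiff ℝ ∞ u) (hv : ContDiff ℝ ∞ v) (hw : ContDiff ℝ ∞ w) :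
    ContMDiff 𝓘(ℝ, V) 𝓘(ℝ, E) ∞ (fun p => F (u p) (v p) (w p)) :=
  hF.comp (hu.prodMk (hv.prodMk hw)).contMDiff

variable (X) in
theorem contMDiff_act {V : Type*} [NormedAddCommGroup V] [NormedSpace ℝ V] {u : V → G} {v : V → H}
    (hu : ContMDiff 𝓘(ℝ, V) 𝓘(ℝ, 𝔤) ∞ u) (hv : ContMDiff 𝓘(ℝ, V) 𝓘(ℝ, 𝔥) ∞ v) :
    ContMDiff 𝓘(ℝ, V) 𝓘(ℝ, 𝔥) ∞ (fun p => X.m (u p) (v p)) :=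
  X.contMDiff_m.comp (hu.prodMk hv)

theorem m_transport (k k' c : G) (P Z : H) :
    X.m (k' * c * (X.t P)⁻¹ * k⁻¹)⁻¹ (X.m k' Z) = X.m k (P * X.m c⁻¹ Z * P⁻¹) := by
  simp [mul_inv_rev, MulAut.mul_apply, X.m_t]

end Helpers

/-- The gauge transform of the cocycle `(f, g, W)` by `(κ, Ψ, Φ)`. -/
def transform [LieGroup 𝓘(ℝ, 𝔤) ∞ G] [LieGroup 𝓘(ℝ, 𝔥) ∞ H] : Cocycle X where
  f x' x y := T.κ x' y * C.f x' x y * (X.t (T.Ψ x' x y))⁻¹ * (T.κ x y)⁻¹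
  g x y' y := T.κ x y' * C.g x y' y * (X.t (T.Φ x y' y))⁻¹ * (T.κ x y)⁻¹
  W x' x y' y := X.m (T.κ x y) (T.Φ x y' y * X.m (C.g x y' y)⁻¹ (T.Ψ x' x y') *
    C.W x' x y' y * (X.m (C.f x' x y)⁻¹ (T.Φ x' y' y))⁻¹ * (T.Ψ x' x y)⁻¹)
  contMDiff_f :=
    (((contMDiff_pair T.contMDiff_κ contDiff_fst (contDiff_snd.comp contDiff_snd)).mul
      C.contMDiff_f).mul (X.contMDiff_t.comp T.contMDiff_Ψ).inv).mul
      (contMDiff_pair T.contMDiff_κ (contDiff_fst.comp contDiff_snd)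
        (contDiff_snd.comp contDiff_snd)).inv
  contMDiff_g :=
    (((contMDiff_pair T.contMDiff_κ contDiff_fst (contDiff_fst.comp contDiff_snd)).mul
      C.contMDiff_g).mul (X.contMDiff_t.comp T.contMDiff_Φ).inv).mul
      (contMDiff_pair T.contMDiff_κ contDiff_fst (contDiff_snd.comp contDiff_snd)).inv
  contMDiff_W := by
    have h1 : ContDiff ℝ ∞ (fun p : ℝ × ℝ × ℝ × ℝ => p.1) := contDiff_fst
    have h2 : ContDiff ℝ ∞ (fun p : ℝ × ℝ × ℝ × ℝ => p.2.1) := by fun_prop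
    have h3 : ContDiff ℝ ∞ (fun p : ℝ × ℝ × ℝ × ℝ => p.2.2.1) := by fun_prop
    have h4 : ContDiff ℝ ∞ (fun p : ℝ × ℝ × ℝ × ℝ => p.2.2.2) := by fun_prop
    exact contMDiff_act X (contMDiff_pair T.contMDiff_κ h2 h4)
      (((((contMDiff_triple T.contMDiff_Φ h2 h3 h4).mul
        (contMDiff_act X (contMDiff_triple C.contMDiff_g h2 h3 h4).inv
          (contMDiff_triple T.contMDiff_Ψ h1 h2 h3))).mul C.contMDiff_W).mul
        (contMDiff_act X (contMDiff_triple C.contMDiff_f h1 h2 h4).inv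
          (contMDiff_triple T.contMDiff_Φ h1 h3 h4)).inv).mul
        (contMDiff_triple T.contMDiff_Ψ h1 h2 h4).inv)
  target x' x y' y := by
    simp only [X.t_m, map_mul X.t, map_inv X.t, C.target]
    group
  f_comp x'' x' x y := by
    simp only [C.f_comp x'' x' x y, T.Ψ_comp x'' x' x y, map_mul X.t, X.t_m]
    group
  g_comp x y'' y' y := by
    simp only [C.g_comp x y'' y' y, T.Φ_comp x y'' y' y, map_mul X.t, X.t_m]
    group
  W_comp_x x'' x' x y' y := by
    rw [m_transport, ← map_mul]
    congr 1
    have key : ∀ Z, X.m (C.f x' x y)⁻¹ (X.m (C.g x' y' y)⁻¹ Z) = (C.W x' x y' y)⁻¹ *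
        X.m (C.g x y' y)⁻¹ (X.m (C.f x' x y')⁻¹ Z) * C.W x' x y' y := by
      intro Z
      have h := X.m_t (C.W x' x y' y)⁻¹ (X.m (C.g x y' y)⁻¹ (X.m (C.f x' x y')⁻¹ Z))
      rw [inv_inv] at h
      rw [← h, map_inv X.t, C.target]
      simp only [← MulAut.mul_apply, ← map_mul]
      congr 2
      group
    simp only [C.f_comp x'' x' x y, T.Ψ_comp x'' x' x, C.W_comp_x x'' x' x y' y,
      mul_inv_rev, map_mul X.m, MulAut.mul_apply, map_mul, map_inv (X.m _), key]
    group
  W_comp_y x' x y'' y' y := by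
    rw [m_transport, ← map_mul]
    congr 1
    have key : ∀ Z, X.m (C.g x y' y)⁻¹ (X.m (C.f x' x y')⁻¹ Z) = C.W x' x y' y *
        X.m (C.f x' x y)⁻¹ (X.m (C.g x' y' y)⁻¹ Z) * (C.W x' x y' y)⁻¹ := by
      intro Z
      rw [← X.m_t, C.target]
      simp only [← MulAut.mul_apply, ← map_mul]
      congr 2
      group
    simp only [C.g_comp _ y'' y' y, T.Φ_comp _ y'' y' y, C.W_comp_y x' x y'' y' y,
      mul_inv_rev, map_mul X.m, MulAut.mul_apply, map_mul, map_inv (X.m _), key]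
    group

end GaugeTransformation

end HigherGauge

end

/-! The composition laws force `f`, `g`, `W`, `Ψ`, `Φ` to equal 1 at coincident arguments. The forms
`a`, `B` and `Γ` are therefore read off from derivatives at the identity, of first order for `a` and
`Γ` and of second order for `B`. Everything becomes a comparison of second-order Taylor data of
group-valued maps in the charts at 1.

`HasTwoJet` records, for a map with value 1 at `p`, its two first derivatives and its mixed second
derivative in such a chart. By the unit laws a product is, to second order, the sum of its factors
plus a bilinear term `mulPairing`, whose antisymmetrization is the Lie bracket
(`bracket_eq_mulPairing`). Likewise the action of `G` on `H` contributes a bilinear term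
`actPairing`, which is `mhat` (`mhat_eq_actPairing`) and which turns into the bracket of `H` after
`tdot` by the Peiffer identity (`actPairing_tdot`). Two ways of writing one map have the same jet
(`HasTwoJet.unique`), so each group identity yields an infinitesimal one.

The mixed component of the target law for `W` gives the vanishing of the fake curvature, for every
cocycle (`tdot_WMixed`, `Cocycle.isConnectionDoublet`); the gauge transform is itself a cocycle, so
its forms are a doublet. First derivatives of `f*` and `g*` give the law for `a*`, and the mixed
component of `W*` gives `WMixed_transform`. It becomes the law for `B*` once `dΓ` is computed: the
derivative of `ϰ` hidden in `ṁ(ϰ)` cancels against the term `dϰ ϰ⁻¹` inside `m̂(a*, Γ)`.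

A mixed second derivative depends on the chart in general, but not when one of the first derivatives
vanishes. This is the case for all the maps whose mixed derivative is interpreted geometrically, in
particular for `W`. -/

noncomputable section

namespace HigherGauge

open Filter Topology

/-! ### Second derivatives of maps between normed spaces. -/

section SecondDerivative

variable {V E F E₁ E₂ : Type*} [NormedAddCommGroup V] [NormedSpace ℝ V]
  [NormedAddCommGroup E] [NormedSpace ℝ E] [NormedAddCommGroup F] [NormedSpace ℝ F]
  [NormedAddCommGroup E₁] [NormedSpace ℝ E₁] [NormedAddCommGroup E₂] [NormedSpace ℝ E₂]

theorem differentiableAt_fderiv {U : V → E} {p : V} (hU : ContDiffAt ℝ ∞ U p) :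
    DifferentiableAt ℝ (fderiv ℝ U) p :=
  (hU.fderiv_right (m := 1) (by norm_cast)).differentiableAt (by simp)

theorem eventually_differentiableAt {U : V → E} {p : V} (hU : ContDiffAt ℝ ∞ U p) :
    ∀ᶠ q in 𝓝 p, DifferentiableAt ℝ U q := by
  have h1 : ContDiffAt ℝ 1 U p := hU.of_le (by norm_cast)
  filter_upwards [h1.eventually (by simp)] with q hq
  exact hq.differentiableAt (by simp)

/-- The first summand is what keeps second derivatives from being chart independent; it drops out as
soon as `U` has zero derivative along `v` or `w`. -/
theorem fderiv_fderiv_comp {M : E → F} {U : V → E} {p : V} (hM : ContDiffAt ℝ ∞ M (U p))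
    (hU : ContDiffAt ℝ ∞ U p) (v w : V) :
    fderiv ℝ (fderiv ℝ (M ∘ U)) p v w =
      fderiv ℝ (fderiv ℝ M) (U p) (fderiv ℝ U p v) (fderiv ℝ U p w) +
        fderiv ℝ M (U p) (fderiv ℝ (fderiv ℝ U) p v w) := by
  have hev : fderiv ℝ (M ∘ U) =ᶠ[𝓝 p] fun q => (fderiv ℝ M (U q)).comp (fderiv ℝ U q) := by
    filter_upwards [hU.continuousAt.eventually (eventually_differentiableAt hM),
      eventually_differentiableAt hU] with q h1 h2
    exact fderiv_comp q h1 h2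
  have hd : DifferentiableAt ℝ U p := hU.differentiableAt (by simp)
  have hdM := differentiableAt_fderiv hM
  have hc : DifferentiableAt ℝ (fun q => fderiv ℝ M (U q)) p := hdM.comp p hd
  have hc' : fderiv ℝ (fun q => fderiv ℝ M (U q)) p =
      (fderiv ℝ (fderiv ℝ M) (U p)).comp (fderiv ℝ U p) := fderiv_comp p hdM hd
  rw [hev.fderiv_eq, fderiv_clm_comp hc (differentiableAt_fderiv hU), hc']
  simp [add_comm]

/-- Apply the second-order chain rule to the two projections, whose own second derivatives vanish.
-/
theorem fderiv_fderiv_prodMk {u : V → E₁} {v : V → E₂} {p : V} (hu : ContDiffAt ℝ ∞ u p)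
    (hv : ContDiffAt ℝ ∞ v p) (a b : V) :
    fderiv ℝ (fderiv ℝ fun q => (u q, v q)) p a b =
      (fderiv ℝ (fderiv ℝ u) p a b, fderiv ℝ (fderiv ℝ v) p a b) := by
  have h := fderiv_fderiv_comp (M := (Prod.fst : E₁ × E₂ → E₁)) contDiffAt_fst
    (hu.prodMk hv) a b
  have h' := fderiv_fderiv_comp (M := (Prod.snd : E₁ × E₂ → E₂)) contDiffAt_snd
    (hu.prodMk hv) a b
  have e1 : fderiv ℝ (Prod.fst : E₁ × E₂ → E₁) = fun _ => ContinuousLinearMap.fst ℝ E₁ E₂ := by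
    ext1 z; exact fderiv_fst
  have e2 : fderiv ℝ (Prod.snd : E₁ × E₂ → E₂) = fun _ => ContinuousLinearMap.snd ℝ E₁ E₂ := by
    ext1 z; exact fderiv_snd
  rw [e1] at h
  rw [e2] at h'
  simp at h h'
  exact Prod.ext h.symm h'.symm

theorem fderiv_fderiv_comm {U : V → E} {p : V} (hU : ContDiffAt ℝ ∞ U p) (v w : V) :
    fderiv ℝ (fderiv ℝ U) p v w = fderiv ℝ (fderiv ℝ U) p w v :=
  (hU.isSymmSndFDerivAt (by simp; norm_cast)).eq v w

theorem fderiv_fderiv_affine (A : E →L[ℝ] F) (c : F) (e : E) :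
    fderiv ℝ (fderiv ℝ fun z => A z + c) e = 0 := by
  have : fderiv ℝ (fun z => A z + c) = fun _ => A := by
    ext1 z; simp
  rw [this]; simp

/-- A smooth map of two variables that is affine in each of them at a base point is, to second
order there, the sum of its linear part and a pairing of the two variables. -/
theorem fderiv_fderiv_of_affine {M : E₁ × E₂ → E} {e : E₁ × E₂} (hM : ContDiffAt ℝ ∞ M e)
    {A : E₁ →L[ℝ] E} {B : E₂ →L[ℝ] E} {c d : E}
    (hA : ∀ᶠ z in 𝓝 e.1, M (z, e.2) = A z + c) (hB : ∀ᶠ z in 𝓝 e.2, M (e.1, z) = B z + d) :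
    (∀ z, fderiv ℝ M e z = A z.1 + B z.2) ∧
    ∀ z z', fderiv ℝ (fderiv ℝ M) e z z' =
      fderiv ℝ (fderiv ℝ M) e (z.1, 0) (0, z'.2) + fderiv ℝ (fderiv ℝ M) e (z'.1, 0) (0, z.2) := by
  have i1 : ContDiffAt ℝ ∞ (fun z : E₁ => (z, e.2)) e.1 := contDiffAt_id.prodMk contDiffAt_const
  have i2 : ContDiffAt ℝ ∞ (fun z : E₂ => (e.1, z)) e.2 := contDiffAt_const.prodMk contDiffAt_id
  have d1 : ∀ z, fderiv ℝ (fun z : E₁ => (z, e.2)) z = ContinuousLinearMap.inl ℝ E₁ E₂ :=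
    fun z => (hasFDerivAt_prodMk_left (𝕜 := ℝ) z e.2).fderiv
  have d2 : ∀ z, fderiv ℝ (fun z : E₂ => (e.1, z)) z = ContinuousLinearMap.inr ℝ E₁ E₂ :=
    fun z => (hasFDerivAt_prodMk_right (𝕜 := ℝ) e.1 z).fderiv
  have dd1 : fderiv ℝ (fun z : E₁ => (z, e.2)) = fun _ => ContinuousLinearMap.inl ℝ E₁ E₂ :=
    funext d1
  have dd2 : fderiv ℝ (fun z : E₂ => (e.1, z)) = fun _ => ContinuousLinearMap.inr ℝ E₁ E₂ :=
    funext d2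
  have hA' : M ∘ (fun z : E₁ => (z, e.2)) =ᶠ[𝓝 e.1] fun z => A z + c := hA
  have hB' : M ∘ (fun z : E₂ => (e.1, z)) =ᶠ[𝓝 e.2] fun z => B z + d := hB
  have hMd : DifferentiableAt ℝ M e := hM.differentiableAt (by simp)
  constructor
  · rintro ⟨x, y⟩
    have h1 := hA'.fderiv_eq (𝕜 := ℝ)
    have h2 := hB'.fderiv_eq (𝕜 := ℝ)
    rw [fderiv_comp e.1 hMd (i1.differentiableAt (by simp)), d1] at h1
    rw [fderiv_comp e.2 hMd (i2.differentiableAt (by simp)), d2] at h2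
    have h1' := DFunLike.congr_fun h1 x
    have h2' := DFunLike.congr_fun h2 y
    simp at h1' h2'
    rw [← h1', ← h2', ← (fderiv ℝ M e).map_add]
    simp
  · rintro ⟨x, y⟩ ⟨x', y'⟩
    have h1 := fderiv_fderiv_comp (p := e.1) hM i1 x x'
    have h2 := fderiv_fderiv_comp (p := e.2) hM i2 y y'
    rw [(hA'.fderiv (𝕜 := ℝ)).fderiv_eq, fderiv_fderiv_affine, dd1] at h1
    rw [(hB'.fderiv (𝕜 := ℝ)).fderiv_eq, fderiv_fderiv_affine, dd2] at h2
    simp at h1 h2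
    -- Of the four terms of the bilinear expansion, the two with both arguments in the same factor
    -- vanish by `h1` and `h2`; symmetry puts the remaining ones in the stated order.
    have e1 : ((x, y) : E₁ × E₂) = (x, 0) + (0, y) := by simp
    have e2 : ((x', y') : E₁ × E₂) = (x', 0) + (0, y') := by simp
    rw [e1, e2]
    simp only [map_add, add_apply]
    rw [← h1, ← h2, fderiv_fderiv_comm hM (0, y) (x', 0)]
    simp only [zero_add, add_zero, Prod.mk_add_mk]
    exact add_comm _ _

/-- Left invariant vector fields and the maps `ṁ(a)` are both partial derivatives, in the second
variable, of a binary operation at the unit. This differentiates such a field as the first variable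
moves. -/
theorem hasFDerivAt_fderiv_inr {M : E₁ × E₂ → E} {e : E₁ × E₂} (hM : ContDiffAt ℝ ∞ M e)
    {l : V → E₁} {y : V → E₂} {l' : V →L[ℝ] E₁} {y' : V →L[ℝ] E₂} {p : V}
    (hl : HasFDerivAt l l' p) (hlp : l p = e.1) (hy : HasFDerivAt y y' p) :
    HasFDerivAt (fun q => fderiv ℝ M (l q, e.2) (0, y q))
      (((fderiv ℝ (fderiv ℝ M) e).comp ((ContinuousLinearMap.inl ℝ E₁ E₂).comp l')).flip (0, y p) +
        (fderiv ℝ M e).comp ((ContinuousLinearMap.inr ℝ E₁ E₂).comp y')) p := by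
  have hpe : (l p, e.2) = e := by rw [hlp]
  have h1 : HasFDerivAt (fun q => (l q, e.2)) ((ContinuousLinearMap.inl ℝ E₁ E₂).comp l') p :=
    (hasFDerivAt_prodMk_left (𝕜 := ℝ) (l p) e.2).comp p hl
  have h2 : HasFDerivAt (fun q => ((0 : E₁), y q)) ((ContinuousLinearMap.inr ℝ E₁ E₂).comp y') p :=
    (hasFDerivAt_prodMk_right (𝕜 := ℝ) (0 : E₁) (y p)).comp p hy
  have h3 := (differentiableAt_fderiv hM).hasFDerivAt
  rw [← hpe] at h3
  have h := (h3.comp p h1).clm_apply h2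
  rw [hpe] at h
  rw [add_comm]
  simpa only [Function.comp_def, hpe] using h

/-- The iterated partial derivative of a map on the plane. -/
theorem deriv_fderiv_snd {U : ℝ × ℝ → E} {p : ℝ × ℝ} (hU : ContDiffAt ℝ ∞ U p) :
    deriv (fun s => fderiv ℝ (fun r => U (s, r)) p.2 1) p.1 =
      fderiv ℝ (fderiv ℝ U) p (1, 0) (0, 1) := by
  have i1 : ∀ z, HasFDerivAt (fun z : ℝ => (z, p.2)) (ContinuousLinearMap.inl ℝ ℝ ℝ) z :=
    fun z => hasFDerivAt_prodMk_left z p.2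
  have hev : (fun s => fderiv ℝ (fun r => U (s, r)) p.2 1) =ᶠ[𝓝 p.1]
      fun s => fderiv ℝ U (s, p.2) (0, 1) := by
    filter_upwards [(i1 p.1).continuousAt.eventually (eventually_differentiableAt hU)] with s hs
    have := hs.hasFDerivAt.comp p.2 (hasFDerivAt_prodMk_right s p.2)
    have h2 := this.fderiv
    simp only [Function.comp_def] at h2
    rw [h2]; simp
  rw [hev.deriv_eq]
  have h := ((differentiableAt_fderiv hU).hasFDerivAt.comp p.1 (i1 p.1)).clm_apply
    (hasFDerivAt_const ((0, 1) : ℝ × ℝ) p.1)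
  have h2 := h.hasDerivAt.deriv
  simp only [Function.comp_def] at h2
  rw [h2]; simp

theorem deriv_fderiv_fst {U : ℝ × ℝ → E} {p : ℝ × ℝ} (hU : ContDiffAt ℝ ∞ U p) :
    deriv (fun r => fderiv ℝ (fun s => U (s, r)) p.1 1) p.2 =
      fderiv ℝ (fderiv ℝ U) p (0, 1) (1, 0) := by
  have i1 : ∀ z, HasFDerivAt (fun z : ℝ => (p.1, z)) (ContinuousLinearMap.inr ℝ ℝ ℝ) z :=
    fun z => hasFDerivAt_prodMk_right p.1 z
  have hev : (fun r => fderiv ℝ (fun s => U (s, r)) p.1 1) =ᶠ[𝓝 p.2]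
      fun r => fderiv ℝ U (p.1, r) (1, 0) := by
    filter_upwards [(i1 p.2).continuousAt.eventually (eventually_differentiableAt hU)] with r hr
    have := hr.hasFDerivAt.comp p.1 (hasFDerivAt_prodMk_left (𝕜 := ℝ) p.1 r)
    have h2 := this.fderiv
    simp only [Function.comp_def] at h2
    rw [h2]; simp
  rw [hev.deriv_eq]
  have h := ((differentiableAt_fderiv hU).hasFDerivAt.comp p.2 (i1 p.2)).clm_apply
    (hasFDerivAt_const ((1, 0) : ℝ × ℝ) p.2)
  have h2 := h.hasDerivAt.deriv
  simp only [Function.comp_def] at h2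
  rw [h2]; simp

end SecondDerivative

/-! ### Two-jets at the identity and their behaviour under maps and binary operations. -/

section Jets

variable {V E N E₁ N₁ E₂ N₂ : Type*} [NormedAddCommGroup V] [NormedSpace ℝ V]
  [NormedAddCommGroup E] [NormedSpace ℝ E] [TopologicalSpace N] [ChartedSpace E N] [One N]
  [NormedAddCommGroup E₁] [NormedSpace ℝ E₁] [TopologicalSpace N₁] [ChartedSpace E₁ N₁] [One N₁]
  [NormedAddCommGroup E₂] [NormedSpace ℝ E₂] [TopologicalSpace N₂] [ChartedSpace E₂ N₂] [One N₂]

variable (E N) in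
/-- The preferred chart at `1`. -/
abbrev chartOne : PartialEquiv N E := extChartAt 𝓘(ℝ, E) (1 : N)

variable (E N) in
/-- The coordinate of `1` in the preferred chart at `1`. -/
abbrev baseOne : E := chartOne E N 1

/-- `u` is a smooth map with `u p = 1` whose coordinate expression in the chart at `1` has first
derivatives `α`, `β` at `p` in the directions `v`, `w` and mixed second derivative `γ`. -/
structure HasTwoJet (u : V → N) (p v w : V) (α β γ : E) : Prop where
  smooth : ContMDiffAt 𝓘(ℝ, V) 𝓘(ℝ, E) ∞ u p
  apply_eq : u p = 1
  fst : fderiv ℝ (fun q => chartOne E N (u q)) p v = α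
  snd : fderiv ℝ (fun q => chartOne E N (u q)) p w = β
  mixed : fderiv ℝ (fderiv ℝ fun q => chartOne E N (u q)) p v w = γ

theorem contDiffAt_chartOne [IsManifold 𝓘(ℝ, E) ∞ N] {u : V → N} {p : V}
    (hu : ContMDiffAt 𝓘(ℝ, V) 𝓘(ℝ, E) ∞ u p) (h : u p = 1) :
    ContDiffAt ℝ ∞ (fun q => chartOne E N (u q)) p := by
  rw [← contMDiffAt_iff_contDiffAt]
  have : ContMDiffAt 𝓘(ℝ, E) 𝓘(ℝ, E) ∞ (chartOne E N) (u p) := by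
    rw [h]; exact contMDiffAt_extChartAt
  exact this.comp p hu

variable (E N) in
theorem contMDiffAt_chartOne_symm [IsManifold 𝓘(ℝ, E) ∞ N] :
    ContMDiffAt 𝓘(ℝ, E) 𝓘(ℝ, E) ∞ (chartOne E N).symm (baseOne E N) :=
  (contMDiffOn_extChartAt_symm (1 : N)).contMDiffAt (extChartAt_target_mem_nhds (1 : N))

variable (E N) in
theorem chartOne_symm_baseOne : (chartOne E N).symm (baseOne E N) = 1 :=
  extChartAt_to_inv (I := 𝓘(ℝ, E)) (1 : N)

theorem eventually_chartOne_symm {V : Type*} [TopologicalSpace V] {u : V → N} {p : V}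
    (hu : ContinuousAt u p) (h : u p = 1) :
    ∀ᶠ q in 𝓝 p, (chartOne E N).symm (chartOne E N (u q)) = u q := by
  have := hu.eventually_mem
    (h.symm ▸ extChartAt_source_mem_nhds (I := 𝓘(ℝ, E)) (1 : N) : (chartOne E N).source ∈ 𝓝 (u p))
  filter_upwards [this] with q hq
  exact PartialEquiv.left_inv (chartOne E N) hq

/-- The manifold derivative at `p`, as a map between the model spaces. -/
def modelDeriv {M N : Type*} (E' E : Type*) [NormedAddCommGroup E'] [NormedSpace ℝ E']
    [NormedAddCommGroup E] [NormedSpace ℝ E] [TopologicalSpace M] [ChartedSpace E' M]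
    [TopologicalSpace N] [ChartedSpace E N] (u : M → N) (p : M) : E' →L[ℝ] E :=
  mfderiv 𝓘(ℝ, E') 𝓘(ℝ, E) u p

/-- The manifold derivative uses the preferred chart at `u p`, which by `h` is the chart at 1. -/
theorem modelDeriv_eq_fderiv {u : V → N} {p : V}
    (hu : MDifferentiableAt 𝓘(ℝ, V) 𝓘(ℝ, E) u p) (h : u p = 1) :
    modelDeriv V E u p = fderiv ℝ (fun q => chartOne E N (u q)) p := by
  have : modelDeriv V E u p =
      fderivWithin ℝ (writtenInExtChartAt 𝓘(ℝ, V) 𝓘(ℝ, E) p u) (Set.range 𝓘(ℝ, V))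
        (extChartAt 𝓘(ℝ, V) p p) := if_pos hu
  rw [this]
  simp only [writtenInExtChartAt, h, Function.comp_def, mfld_simps, fderivWithin_univ]
  rfl

theorem modelDeriv_one_eq_fderiv {F : N₁ → N}
    (hF : MDifferentiableAt 𝓘(ℝ, E₁) 𝓘(ℝ, E) F 1) (h : F 1 = 1) :
    modelDeriv E₁ E F (1 : N₁) =
      fderiv ℝ (fun z => chartOne E N (F ((chartOne E₁ N₁).symm z))) (baseOne E₁ N₁) := by
  have : modelDeriv E₁ E F (1 : N₁) =
      fderivWithin ℝ (writtenInExtChartAt 𝓘(ℝ, E₁) 𝓘(ℝ, E) 1 F) (Set.range 𝓘(ℝ, E₁))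
        (extChartAt 𝓘(ℝ, E₁) (1 : N₁) 1) := if_pos hF
  rw [this]
  simp only [writtenInExtChartAt, h, Function.comp_def, mfld_simps, fderivWithin_univ]
  rfl

namespace HasTwoJet

variable {u : V → N} {p v w : V} {α β γ : E}

theorem symm [IsManifold 𝓘(ℝ, E) ∞ N] (h : HasTwoJet u p v w α β γ) :
    HasTwoJet u p w v β α γ :=
  ⟨h.smooth, h.apply_eq, h.snd, h.fst,
    (fderiv_fderiv_comm (contDiffAt_chartOne h.smooth h.apply_eq) w v).trans h.mixed⟩

theorem congr_fun' (h : HasTwoJet u p v w α β γ) {u' : V → N} (h' : u' = u) :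
    HasTwoJet u' p v w α β γ := h' ▸ h

/-- The zero in the first slot kills the second derivative of `F` in the chain rule, so the mixed
component transforms like a tangent vector. -/
theorem map [IsManifold 𝓘(ℝ, E) ∞ N] [IsManifold 𝓘(ℝ, E₁) ∞ N₁] {u : V → N₁} {β γ : E₁}
    (h : HasTwoJet u p v w 0 β γ) {F : N₁ → N}
    (hF : ContMDiffAt 𝓘(ℝ, E₁) 𝓘(ℝ, E) ∞ F 1) (h1 : F 1 = 1) :
    HasTwoJet (fun q => F (u q)) p v w 0
      (modelDeriv E₁ E F (1 : N₁) β)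
      (modelDeriv E₁ E F (1 : N₁) γ) := by
  rw [modelDeriv_one_eq_fderiv (hF.mdifferentiableAt (by simp)) h1]
  set L : E₁ → E := fun z => chartOne E N (F ((chartOne E₁ N₁).symm z)) with hL
  have hs := contMDiffAt_chartOne_symm E₁ N₁
  have h0 := chartOne_symm_baseOne E₁ N₁
  have hLs : ContDiffAt ℝ ∞ L (baseOne E₁ N₁) := by
    refine contDiffAt_chartOne (u := fun z => F ((chartOne E₁ N₁).symm z)) ?_ (by rw [h0, h1])
    exact ContMDiffAt.comp _ (by rw [h0]; exact hF) hs
  have hu := contDiffAt_chartOne h.smooth h.apply_eq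
  have hup : chartOne E₁ N₁ (u p) = baseOne E₁ N₁ := by rw [h.apply_eq]
  have hev : (fun q => chartOne E N (F (u q))) =ᶠ[𝓝 p] L ∘ fun q => chartOne E₁ N₁ (u q) := by
    filter_upwards [eventually_chartOne_symm (E := E₁) h.smooth.continuousAt h.apply_eq] with q hq
    simp only [hL, Function.comp, hq]
  have hd : fderiv ℝ (fun q => chartOne E N (F (u q))) p =
      (fderiv ℝ L (baseOne E₁ N₁)).comp (fderiv ℝ (fun q => chartOne E₁ N₁ (u q)) p) := by
    rw [hev.fderiv_eq, fderiv_comp p (by rw [hup]; exact hLs.differentiableAt (by simp))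
      (hu.differentiableAt (by simp)), hup]
  refine ⟨ContMDiffAt.comp p (by rw [h.apply_eq]; exact hF) h.smooth, by rw [h.apply_eq, h1],
    ?_, ?_, ?_⟩
  · rw [hd, ContinuousLinearMap.comp_apply, h.fst, map_zero]
  · rw [hd, ContinuousLinearMap.comp_apply, h.snd]
  · rw [hev.fderiv.fderiv_eq, fderiv_fderiv_comp (by rw [hup]; exact hLs) hu, h.fst, h.snd,
      h.mixed, hup]
    simp

end HasTwoJet

/-- The coordinate expression of a binary operation. -/
def chartOp (M : N₁ → N₂ → N) (z : E₁ × E₂) : E :=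
  chartOne E N (M ((chartOne E₁ N₁).symm z.1) ((chartOne E₂ N₂).symm z.2))

/-- The mixed second derivative at `(1, 1)` of the coordinate expression of a binary operation. -/
def pairing (M : N₁ → N₂ → N) : E₁ →L[ℝ] E₂ →L[ℝ] E :=
  (fderiv ℝ (fderiv ℝ (chartOp (E := E) (E₁ := E₁) (E₂ := E₂) M))
    (baseOne E₁ N₁, baseOne E₂ N₂)).bilinearComp
    (ContinuousLinearMap.inl ℝ E₁ E₂) (ContinuousLinearMap.inr ℝ E₁ E₂)

theorem pairing_apply (M : N₁ → N₂ → N) (x : E₁) (y : E₂) :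
    (pairing M x y : E) = fderiv ℝ (fderiv ℝ (chartOp (E := E) M))
      (baseOne E₁ N₁, baseOne E₂ N₂) (x, 0) (0, y) := rfl

variable [IsManifold 𝓘(ℝ, E) ∞ N] [IsManifold 𝓘(ℝ, E₁) ∞ N₁] [IsManifold 𝓘(ℝ, E₂) ∞ N₂]

theorem contDiffAt_chartOp {M : N₁ → N₂ → N}
    (hM : ContMDiff (𝓘(ℝ, E₁).prod 𝓘(ℝ, E₂)) 𝓘(ℝ, E) ∞ fun z : N₁ × N₂ => M z.1 z.2)
    (h1 : M 1 1 = 1) :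
    ContDiffAt ℝ ∞ (chartOp (E := E) (E₁ := E₁) (E₂ := E₂) M)
      (baseOne E₁ N₁, baseOne E₂ N₂) := by
  refine contDiffAt_chartOne
    (u := fun z : E₁ × E₂ => M ((chartOne E₁ N₁).symm z.1) ((chartOne E₂ N₂).symm z.2)) ?_
    (by rw [chartOne_symm_baseOne, chartOne_symm_baseOne, h1])
  have k1 : ContMDiffAt 𝓘(ℝ, E₁ × E₂) 𝓘(ℝ, E₁) ∞
      (fun z : E₁ × E₂ => (chartOne E₁ N₁).symm z.1) (baseOne E₁ N₁, baseOne E₂ N₂) :=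
    ContMDiffAt.comp (g := (chartOne E₁ N₁).symm) (I' := 𝓘(ℝ, E₁)) _
      (contMDiffAt_chartOne_symm E₁ N₁) contDiffAt_fst.contMDiffAt
  have k2 : ContMDiffAt 𝓘(ℝ, E₁ × E₂) 𝓘(ℝ, E₂) ∞
      (fun z : E₁ × E₂ => (chartOne E₂ N₂).symm z.2) (baseOne E₁ N₁, baseOne E₂ N₂) :=
    ContMDiffAt.comp (g := (chartOne E₂ N₂).symm) (I' := 𝓘(ℝ, E₂)) _
      (contMDiffAt_chartOne_symm E₂ N₂) contDiffAt_snd.contMDiffAt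
  exact hM.contMDiffAt.comp _ (k1.prodMk k2)

namespace HasTwoJet

variable {p v w : V}

/-- The hypotheses `hA` and `hB` remove the pure second derivatives of `M` at the unit, leaving its
linear part and the pairing of the two variables. -/
theorem binary {M : N₁ → N₂ → N}
    (hM : ContMDiff (𝓘(ℝ, E₁).prod 𝓘(ℝ, E₂)) 𝓘(ℝ, E) ∞ fun z : N₁ × N₂ => M z.1 z.2)
    (h1 : M 1 1 = 1) {A : E₁ →L[ℝ] E} {B : E₂ →L[ℝ] E} {c d : E}
    (hA : ∀ᶠ z in 𝓝 (baseOne E₁ N₁), chartOp M (z, baseOne E₂ N₂) = A z + c)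
    (hB : ∀ᶠ z in 𝓝 (baseOne E₂ N₂), chartOp M (baseOne E₁ N₁, z) = B z + d)
    {u₁ : V → N₁} {u₂ : V → N₂} {α₁ β₁ γ₁ : E₁} {α₂ β₂ γ₂ : E₂}
    (hu₁ : HasTwoJet u₁ p v w α₁ β₁ γ₁) (hu₂ : HasTwoJet u₂ p v w α₂ β₂ γ₂) :
    HasTwoJet (fun q => M (u₁ q) (u₂ q)) p v w (A α₁ + B α₂) (A β₁ + B β₂)
      (A γ₁ + B γ₂ + pairing M α₁ β₂ + pairing M β₁ α₂) := by
  have hc := contDiffAt_chartOp hM h1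
  obtain ⟨f1, f2⟩ := fderiv_fderiv_of_affine hc hA hB
  have c1 := contDiffAt_chartOne hu₁.smooth hu₁.apply_eq
  have c2 := contDiffAt_chartOne hu₂.smooth hu₂.apply_eq
  set U : V → E₁ × E₂ := fun q => (chartOne E₁ N₁ (u₁ q), chartOne E₂ N₂ (u₂ q)) with hU
  have hUs : ContDiffAt ℝ ∞ U p := c1.prodMk c2
  have hup : U p = (baseOne E₁ N₁, baseOne E₂ N₂) := by
    simp only [hU, hu₁.apply_eq, hu₂.apply_eq]
  have hUd : ∀ a, fderiv ℝ U p a = (fderiv ℝ (fun q => chartOne E₁ N₁ (u₁ q)) p a,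
      fderiv ℝ (fun q => chartOne E₂ N₂ (u₂ q)) p a) := fun a => by
    rw [hU, DifferentiableAt.fderiv_prodMk (c1.differentiableAt (by simp))
      (c2.differentiableAt (by simp))]
    rfl
  have hev : (fun q => chartOne E N (M (u₁ q) (u₂ q))) =ᶠ[𝓝 p] chartOp M ∘ U := by
    filter_upwards [eventually_chartOne_symm (E := E₁) hu₁.smooth.continuousAt hu₁.apply_eq,
      eventually_chartOne_symm (E := E₂) hu₂.smooth.continuousAt hu₂.apply_eq] with q h h'
    simp only [hU, chartOp, Function.comp, h, h']
  have hd : ∀ a, fderiv ℝ (fun q => chartOne E N (M (u₁ q) (u₂ q))) p a =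
      A (fderiv ℝ (fun q => chartOne E₁ N₁ (u₁ q)) p a) +
      B (fderiv ℝ (fun q => chartOne E₂ N₂ (u₂ q)) p a) := fun a => by
    rw [hev.fderiv_eq, fderiv_comp p (by rw [hup]; exact hc.differentiableAt (by simp))
      (hUs.differentiableAt (by simp)), hup, ContinuousLinearMap.comp_apply, f1, hUd]
  refine ⟨hM.contMDiffAt.comp p (hu₁.smooth.prodMk hu₂.smooth), ?_, ?_, ?_, ?_⟩
  · rw [hu₁.apply_eq, hu₂.apply_eq, h1]
  · rw [hd, hu₁.fst, hu₂.fst]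
  · rw [hd, hu₁.snd, hu₂.snd]
  · rw [hev.fderiv.fderiv_eq, fderiv_fderiv_comp (by rw [hup]; exact hc) hUs, hup, f2, f1, hUd,
      hUd, fderiv_fderiv_prodMk c1 c2, hu₁.fst, hu₁.snd, hu₂.fst, hu₂.snd, hu₁.mixed, hu₂.mixed,
      pairing_apply, pairing_apply]
    simp only
    abel

end HasTwoJet

end Jets

/-! ### Jets of products and inverses, and the Lie bracket as their second-order defect. -/

section Group

variable {V 𝔤 G : Type*} [NormedAddCommGroup V] [NormedSpace ℝ V]
  [NormedAddCommGroup 𝔤] [NormedSpace ℝ 𝔤] [TopologicalSpace G] [ChartedSpace 𝔤 G] [Group G]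

variable (𝔤 G) in
theorem eventually_chartOne_right_inv :
    ∀ᶠ z in 𝓝 (baseOne 𝔤 G), chartOne 𝔤 G ((chartOne 𝔤 G).symm z) = z := by
  filter_upwards [extChartAt_target_mem_nhds (I := 𝓘(ℝ, 𝔤)) (1 : G)] with z hz
  exact PartialEquiv.right_inv (chartOne 𝔤 G) hz

variable (𝔤 G) in
/-- The second order part of the product of `G` at `(1, 1)`. -/
abbrev mulPairing : 𝔤 →L[ℝ] 𝔤 →L[ℝ] 𝔤 :=
  pairing (N := G) (N₁ := G) (N₂ := G) fun a b => a * b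

theorem eventually_chartOp_mul_one :
    ∀ᶠ z in 𝓝 (baseOne 𝔤 G), chartOp (E := 𝔤) (fun a b : G => a * b) (z, baseOne 𝔤 G) =
      ContinuousLinearMap.id ℝ 𝔤 z + 0 := by
  filter_upwards [eventually_chartOne_right_inv 𝔤 G] with z hz
  simp only [chartOp]
  rw [chartOne_symm_baseOne, mul_one, hz]; simp

theorem eventually_chartOp_one_mul :
    ∀ᶠ z in 𝓝 (baseOne 𝔤 G), chartOp (E := 𝔤) (fun a b : G => a * b) (baseOne 𝔤 G, z) =
      ContinuousLinearMap.id ℝ 𝔤 z + 0 := by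
  filter_upwards [eventually_chartOne_right_inv 𝔤 G] with z hz
  simp only [chartOp]
  rw [chartOne_symm_baseOne, one_mul, hz]; simp

namespace HasTwoJet

theorem of_contMDiffAt {u : V → G} {p : V} (hu : ContMDiffAt 𝓘(ℝ, V) 𝓘(ℝ, 𝔤) ∞ u p)
    (h1 : u p = 1) (v w : V) :
    HasTwoJet u p v w (modelDeriv V 𝔤 u p v) (modelDeriv V 𝔤 u p w)
      (fderiv ℝ (fderiv ℝ fun q => chartOne 𝔤 G (u q)) p v w) := by
  have h := modelDeriv_eq_fderiv (hu.mdifferentiableAt (by simp)) h1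
  exact ⟨hu, h1, by rw [h], by rw [h], rfl⟩

theorem one (p v w : V) : HasTwoJet (fun _ => (1 : G)) p v w (0 : 𝔤) 0 0 :=
  ⟨contMDiffAt_const, rfl, by simp, by simp, by simp⟩

/-- This is the device that turns a group identity into an infinitesimal one: compute the jets of
both sides and compare. -/
theorem unique {u : V → G} {p v w : V} {α β γ α' β' γ' : 𝔤} (h : HasTwoJet u p v w α β γ)
    (h' : HasTwoJet u p v w α' β' γ') : α = α' ∧ β = β' ∧ γ = γ' :=
  ⟨h.fst.symm.trans h'.fst, h.snd.symm.trans h'.snd, h.mixed.symm.trans h'.mixed⟩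

variable [LieGroup 𝓘(ℝ, 𝔤) ∞ G]

theorem mul {u u' : V → G} {p v w : V} {α β γ α' β' γ' : 𝔤} (h : HasTwoJet u p v w α β γ)
    (h' : HasTwoJet u' p v w α' β' γ') :
    HasTwoJet (fun q => u q * u' q) p v w (α + α') (β + β')
      (γ + γ' + mulPairing 𝔤 G α β' + mulPairing 𝔤 G β α') := by
  exact HasTwoJet.binary (M := fun a b : G => a * b) (contMDiff_mul _ _) (mul_one 1)
    eventually_chartOp_mul_one eventually_chartOp_one_mul h h'

/-- Solve for the unknown jet of the inverse in the product rule for `u * u⁻¹ = 1`. -/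
theorem inv {u : V → G} {p v w : V} {α β γ : 𝔤} (h : HasTwoJet u p v w α β γ) :
    HasTwoJet (fun q => (u q)⁻¹) p v w (-α) (-β)
      (-γ + mulPairing 𝔤 G α β + mulPairing 𝔤 G β α) := by
  have h' := of_contMDiffAt h.smooth.inv (by simp [h.apply_eq]) v w
  obtain ⟨e1, e2, e3⟩ := (h.mul h').unique ((one p v w).congr_fun' (by simp))
  have e1' := eq_neg_of_add_eq_zero_right e1
  have e2' := eq_neg_of_add_eq_zero_right e2
  rw [e1', e2'] at h' e3
  convert h' using 1
  rw [← sub_eq_zero, ← neg_eq_zero, ← e3]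
  simp only [map_neg]
  abel

end HasTwoJet

section Bracket

open VectorField

variable [LieGroup 𝓘(ℝ, 𝔤) ∞ G]

/-- The coordinate expression of a left invariant vector field. -/
theorem eventually_mpullbackWithin_mulInvariantVectorField (x : 𝔤) :
    ∀ᶠ z in 𝓝 (baseOne 𝔤 G), (mpullbackWithin 𝓘(ℝ, 𝔤) 𝓘(ℝ, 𝔤) (chartOne 𝔤 G).symm
      (mulInvariantVectorField (I := 𝓘(ℝ, 𝔤)) (G := G) x) (Set.range 𝓘(ℝ, 𝔤)) z : 𝔤) =
      fderiv ℝ (chartOp (E := 𝔤) fun a b : G => a * b) (z, baseOne 𝔤 G) (0, x) := by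
  have hc := contDiffAt_chartOp (E := 𝔤) (M := fun a b : G => a * b)
    (contMDiff_mul 𝓘(ℝ, 𝔤) ∞) (mul_one 1)
  have ht : ContinuousAt (fun z : 𝔤 => (z, baseOne 𝔤 G)) (baseOne 𝔤 G) := by fun_prop
  filter_upwards [extChartAt_target_mem_nhds (I := 𝓘(ℝ, 𝔤)) (1 : G),
    ht.eventually (eventually_differentiableAt hc)] with z hz hd
  -- The chart and its inverse have mutually inverse differentials, so pulling back along the
  -- inverse chart is pushing forward along the chart.
  have hinv : (mfderivWithin 𝓘(ℝ, 𝔤) 𝓘(ℝ, 𝔤) (chartOne 𝔤 G).symm (Set.range 𝓘(ℝ, 𝔤)) z).inverse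
      = mfderiv 𝓘(ℝ, 𝔤) 𝓘(ℝ, 𝔤) (chartOne 𝔤 G) ((chartOne 𝔤 G).symm z) :=
    ContinuousLinearMap.inverse_eq (mfderivWithin_extChartAt_symm_comp_mfderiv_extChartAt hz)
      (mfderiv_extChartAt_comp_mfderivWithin_extChartAt_symm hz)
  have hsrc : (chartOne 𝔤 G).symm z ∈ (chartAt 𝔤 (1 : G)).source := by
    rw [← extChartAt_source (I := 𝓘(ℝ, 𝔤))]
    exact PartialEquiv.map_target (chartOne 𝔤 G) hz
  set g := (chartOne 𝔤 G).symm z with hg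
  have hm : MDifferentiableAt 𝓘(ℝ, 𝔤) 𝓘(ℝ, 𝔤) (fun b : G => g * b) 1 :=
    (contMDiff_mul_left (I := 𝓘(ℝ, 𝔤)) (n := ∞)).contMDiffAt.mdifferentiableAt (by simp)
  have hch : MDifferentiableAt 𝓘(ℝ, 𝔤) 𝓘(ℝ, 𝔤) (chartOne 𝔤 G) ((fun b : G => g * b) 1) := by
    simp only [mul_one]
    exact mdifferentiableAt_extChartAt hsrc
  have hcomp := mfderiv_comp (1 : G) hch hm
  have h1 : mpullbackWithin 𝓘(ℝ, 𝔤) 𝓘(ℝ, 𝔤) (chartOne 𝔤 G).symm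
      (mulInvariantVectorField (I := 𝓘(ℝ, 𝔤)) (G := G) x) (Set.range 𝓘(ℝ, 𝔤)) z =
      modelDeriv 𝔤 𝔤 (chartOne 𝔤 G ∘ fun b : G => g * b) 1 x := by
    have hcomp' : modelDeriv 𝔤 𝔤 (chartOne 𝔤 G ∘ fun b : G => g * b) 1 =
        (modelDeriv 𝔤 𝔤 (chartOne 𝔤 G) (g * 1)).comp (modelDeriv 𝔤 𝔤 (fun b : G => g * b) 1) :=
      hcomp
    rw [hcomp', mul_one]
    exact DFunLike.congr_fun hinv (mulInvariantVectorField (I := 𝓘(ℝ, 𝔤)) (G := G) x g)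
  have h2 : modelDeriv 𝔤 𝔤 (chartOne 𝔤 G ∘ fun b : G => g * b) 1 =
      fderiv ℝ (fun y => chartOp (E := 𝔤) (fun a b : G => a * b) (z, y)) (baseOne 𝔤 G) := by
    have : modelDeriv 𝔤 𝔤 (chartOne 𝔤 G ∘ fun b : G => g * b) 1 =
      fderivWithin ℝ (writtenInExtChartAt 𝓘(ℝ, 𝔤) 𝓘(ℝ, 𝔤) 1 (chartOne 𝔤 G ∘ fun b : G => g * b))
        (Set.range 𝓘(ℝ, 𝔤)) (extChartAt 𝓘(ℝ, 𝔤) (1 : G) 1) := if_pos (hch.comp 1 hm)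
    rw [this]
    simp only [writtenInExtChartAt, Function.comp_def, mfld_simps, fderivWithin_univ]
    rfl
  rw [h1, h2]
  have h3 := hd.hasFDerivAt.comp (baseOne 𝔤 G)
    (hasFDerivAt_prodMk_right (𝕜 := ℝ) z (baseOne 𝔤 G))
  simp only [Function.comp_def] at h3
  rw [h3.fderiv]
  rfl

/-- In the chart the left invariant field of `x` has value `x` at the unit and derivative
`mulPairing y x` there in the direction `y`; insert this in the coordinate formula for the bracket
of vector fields. -/
theorem bracket_eq_mulPairing (x y : 𝔤) :
    bracket G x y = mulPairing 𝔤 G x y - mulPairing 𝔤 G y x := by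
  have hc := contDiffAt_chartOp (E := 𝔤) (M := fun a b : G => a * b)
    (contMDiff_mul 𝓘(ℝ, 𝔤) ∞) (mul_one 1)
  obtain ⟨f1, -⟩ := fderiv_fderiv_of_affine hc eventually_chartOp_mul_one
    eventually_chartOp_one_mul
  set F : 𝔤 → 𝔤 → 𝔤 := fun x z =>
    fderiv ℝ (chartOp (E := 𝔤) fun a b : G => a * b) (z, baseOne 𝔤 G) (0, x) with hF
  have hF0 : ∀ x, F x (baseOne 𝔤 G) = x := fun x => by
    simp only [hF, f1]; simp
  have hFd : ∀ x y, fderiv ℝ (F x) (baseOne 𝔤 G) y = mulPairing 𝔤 G y x := fun x y => by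
    have h := hasFDerivAt_fderiv_inr hc (hasFDerivAt_id (𝕜 := ℝ) (baseOne 𝔤 G)) rfl
      (hasFDerivAt_const x (baseOne 𝔤 G))
    have h' : HasFDerivAt (F x) _ (baseOne 𝔤 G) := h
    rw [h'.fderiv]
    simp [pairing_apply]
  -- The bracket on the manifold is the bracket in coordinates pulled back by the differential of
  -- the chart, which is the identity at the base point.
  have hid : (mfderiv 𝓘(ℝ, 𝔤) 𝓘(ℝ, 𝔤) (chartOne 𝔤 G) 1).inverse =
      ContinuousLinearMap.id ℝ 𝔤 := by
    rw [mfderiv_extChartAt_self]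
    exact ContinuousLinearMap.inverse_id
  have h1 : bracket G x y = lieBracketWithin ℝ
      (mpullbackWithin 𝓘(ℝ, 𝔤) 𝓘(ℝ, 𝔤) (chartOne 𝔤 G).symm
        (mulInvariantVectorField (I := 𝓘(ℝ, 𝔤)) (G := G) x) (Set.range 𝓘(ℝ, 𝔤)))
      (mpullbackWithin 𝓘(ℝ, 𝔤) 𝓘(ℝ, 𝔤) (chartOne 𝔤 G).symm
        (mulInvariantVectorField (I := 𝓘(ℝ, 𝔤)) (G := G) y) (Set.range 𝓘(ℝ, 𝔤)))
      ((chartOne 𝔤 G).symm ⁻¹' Set.univ ∩ Set.range 𝓘(ℝ, 𝔤)) (baseOne 𝔤 G) :=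
    DFunLike.congr_fun hid _
  have hx : _ =ᶠ[𝓝 (baseOne 𝔤 G)] F x :=
    eventually_mpullbackWithin_mulInvariantVectorField (G := G) x
  have hy : _ =ᶠ[𝓝 (baseOne 𝔤 G)] F y :=
    eventually_mpullbackWithin_mulInvariantVectorField (G := G) y
  have h2 : bracket G x y = lieBracketWithin ℝ (F x) (F y)
      ((chartOne 𝔤 G).symm ⁻¹' Set.univ ∩ Set.range 𝓘(ℝ, 𝔤)) (baseOne 𝔤 G) :=
    h1.trans (hx.lieBracketWithin_vectorField_eq_nhds hy)
  rw [h2]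
  simp only [Set.preimage_univ, modelWithCornersSelf_coe, Set.range_id, Set.univ_inter]
  rw [lieBracketWithin_univ, lieBracket_eq]
  simp only [hF0, hFd]

end Bracket

end Group

/-! ### Jets of maps depending on one coordinate, and curves with given velocity. -/

section Plane

variable {𝔤 G : Type*}
  [NormedAddCommGroup 𝔤] [NormedSpace ℝ 𝔤] [TopologicalSpace G] [ChartedSpace 𝔤 G] [Group G]
  [LieGroup 𝓘(ℝ, 𝔤) ∞ G]

namespace HasTwoJet

theorem comp_fst {u : ℝ → G} {p : ℝ × ℝ} (hu : ContMDiffAt 𝓘(ℝ, ℝ) 𝓘(ℝ, 𝔤) ∞ u p.1)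
    (h1 : u p.1 = 1) :
    HasTwoJet (fun q : ℝ × ℝ => u q.1) p (1, 0) (0, 1) (modelDeriv ℝ 𝔤 u p.1 1) 0 0 := by
  have hc := contDiffAt_chartOne hu h1
  have hf : ∀ z, fderiv ℝ (Prod.fst : ℝ × ℝ → ℝ) z = .fst ℝ ℝ ℝ := fun z => fderiv_fst
  have hd : fderiv ℝ (fun q : ℝ × ℝ => chartOne 𝔤 G (u q.1)) p =
      (fderiv ℝ (fun s => chartOne 𝔤 G (u s)) p.1).comp (.fst ℝ ℝ ℝ) := by
    rw [← hf p, ← fderiv_comp p (hc.differentiableAt (by simp)) differentiableAt_fst]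
    rfl
  refine ⟨hu.comp p contDiffAt_fst.contMDiffAt, h1, ?_, ?_, ?_⟩
  · rw [hd, modelDeriv_eq_fderiv (hu.mdifferentiableAt (by simp)) h1]; rfl
  · rw [hd]; simp
  · have := fderiv_fderiv_comp (U := (Prod.fst : ℝ × ℝ → ℝ)) hc contDiffAt_fst (1, 0) (0, 1)
    rw [funext hf] at this
    simp only [Function.comp_def] at this
    rw [this]
    simp

theorem comp_snd {u : ℝ → G} {p : ℝ × ℝ} (hu : ContMDiffAt 𝓘(ℝ, ℝ) 𝓘(ℝ, 𝔤) ∞ u p.2)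
    (h1 : u p.2 = 1) :
    HasTwoJet (fun q : ℝ × ℝ => u q.2) p (1, 0) (0, 1) 0 (modelDeriv ℝ 𝔤 u p.2 1) 0 := by
  have hc := contDiffAt_chartOne hu h1
  have hf : ∀ z, fderiv ℝ (Prod.snd : ℝ × ℝ → ℝ) z = .snd ℝ ℝ ℝ := fun z => fderiv_snd
  have hd : fderiv ℝ (fun q : ℝ × ℝ => chartOne 𝔤 G (u q.2)) p =
      (fderiv ℝ (fun s => chartOne 𝔤 G (u s)) p.2).comp (.snd ℝ ℝ ℝ) := by
    rw [← hf p, ← fderiv_comp p (hc.differentiableAt (by simp)) differentiableAt_snd]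
    rfl
  refine ⟨hu.comp p contDiffAt_snd.contMDiffAt, h1, ?_, ?_, ?_⟩
  · rw [hd]; simp
  · rw [hd, modelDeriv_eq_fderiv (hu.mdifferentiableAt (by simp)) h1]; rfl
  · have := fderiv_fderiv_comp (U := (Prod.snd : ℝ × ℝ → ℝ)) hc contDiffAt_snd (1, 0) (0, 1)
    rw [funext hf] at this
    simp only [Function.comp_def] at this
    rw [this]
    simp

end HasTwoJet

variable (G) in
/-- Every tangent vector at `1` is the velocity of a smooth curve. -/
theorem exists_curve (x : 𝔤) : ∃ u : ℝ → G, ContMDiffAt 𝓘(ℝ, ℝ) 𝓘(ℝ, 𝔤) ∞ u 0 ∧ u 0 = 1 ∧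
    modelDeriv ℝ 𝔤 u 0 1 = x := by
  have h0 : (chartOne 𝔤 G).symm (baseOne 𝔤 G + (0 : ℝ) • x) = 1 := by
    rw [zero_smul, add_zero, chartOne_symm_baseOne]
  have hl : ContDiff ℝ ∞ fun s : ℝ => baseOne 𝔤 G + s • x := by fun_prop
  have hs : ContMDiffAt 𝓘(ℝ, ℝ) 𝓘(ℝ, 𝔤) ∞
      (fun s : ℝ => (chartOne 𝔤 G).symm (baseOne 𝔤 G + s • x)) 0 := by
    refine ContMDiffAt.comp (g := (chartOne 𝔤 G).symm) (I' := 𝓘(ℝ, 𝔤)) _ ?_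
      hl.contDiffAt.contMDiffAt
    simpa using contMDiffAt_chartOne_symm 𝔤 G
  refine ⟨_, hs, h0, ?_⟩
  rw [modelDeriv_eq_fderiv (hs.mdifferentiableAt (by simp)) h0]
  have hev : (fun s : ℝ => chartOne 𝔤 G ((chartOne 𝔤 G).symm (baseOne 𝔤 G + s • x))) =ᶠ[𝓝 0]
      fun s => baseOne 𝔤 G + s • x := by
    have ht : Tendsto (fun s : ℝ => baseOne 𝔤 G + s • x) (𝓝 0) (𝓝 (baseOne 𝔤 G)) := by
      have := hl.continuous.tendsto 0
      simpa using this
    exact ht.eventually (eventually_chartOne_right_inv 𝔤 G)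
  rw [hev.fderiv_eq]
  have hd : HasDerivAt (fun s : ℝ => baseOne 𝔤 G + s • x) x 0 := by
    simpa using ((hasDerivAt_id (0 : ℝ)).smul_const x).const_add (baseOne 𝔤 G)
  rw [fderiv_apply_one_eq_deriv, hd.deriv]

end Plane

/-! ### Infinitesimal identities of a Lie crossed module. -/

section CrossedModule

variable {V 𝔤 𝔥 G H : Type*} [NormedAddCommGroup V] [NormedSpace ℝ V]
  [NormedAddCommGroup 𝔤] [NormedSpace ℝ 𝔤] [NormedAddCommGroup 𝔥] [NormedSpace ℝ 𝔥]
  [TopologicalSpace G] [ChartedSpace 𝔤 G] [Group G] [LieGroup 𝓘(ℝ, 𝔤) ∞ G]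
  [TopologicalSpace H] [ChartedSpace 𝔥 H] [Group H] [LieGroup 𝓘(ℝ, 𝔥) ∞ H]

theorem contMDiff_conj (k : G) : ContMDiff 𝓘(ℝ, 𝔤) 𝓘(ℝ, 𝔤) ∞ fun b : G => k * b * k⁻¹ :=
  (contMDiff_const.mul contMDiff_id).mul contMDiff_const

theorem HasTwoJet.conj (k : G) {u : V → G} {p v w : V} {β γ : 𝔤}
    (h : HasTwoJet u p v w 0 β γ) :
    HasTwoJet (fun q => k * u q * k⁻¹) p v w 0 (Ad k β) (Ad k γ) :=
  h.map (contMDiff_conj k).contMDiffAt (by simp)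

namespace LieCrossedModule

variable (X : LieCrossedModule 𝔤 𝔥 G H)

/-- The second order part of the action of `G` on `H` at `(1, 1)`. -/
abbrev actPairing : 𝔤 →L[ℝ] 𝔥 →L[ℝ] 𝔥 := pairing fun (a : G) (A : H) => X.m a A

omit [LieGroup 𝓘(ℝ, 𝔤) ∞ G] [LieGroup 𝓘(ℝ, 𝔥) ∞ H] in
theorem contMDiff_m_apply (a : G) : ContMDiff 𝓘(ℝ, 𝔥) 𝓘(ℝ, 𝔥) ∞ (X.m a) :=
  X.contMDiff_m.comp (contMDiff_const.prodMk contMDiff_id)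

omit [LieGroup 𝓘(ℝ, 𝔤) ∞ G] [LieGroup 𝓘(ℝ, 𝔥) ∞ H] in
theorem chartOp_m_one (z : 𝔤) :
    chartOp (E := 𝔥) (fun (a : G) (A : H) => X.m a A) (z, baseOne 𝔥 H) =
      (0 : 𝔤 →L[ℝ] 𝔥) z + baseOne 𝔥 H := by
  simp only [chartOp]
  rw [chartOne_symm_baseOne, map_one, zero_apply, zero_add]

omit [LieGroup 𝓘(ℝ, 𝔤) ∞ G] [LieGroup 𝓘(ℝ, 𝔥) ∞ H] in
theorem eventually_chartOp_one_m :
    ∀ᶠ z in 𝓝 (baseOne 𝔥 H), chartOp (E := 𝔥) (fun (a : G) (A : H) => X.m a A)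
      (baseOne 𝔤 G, z) = ContinuousLinearMap.id ℝ 𝔥 z + 0 := by
  filter_upwards [eventually_chartOne_right_inv 𝔥 H] with z hz
  simp only [chartOp]
  rw [chartOne_symm_baseOne, map_one]
  simpa using hz

/-- Every group element fixes `1`, so the acting variable has no linear contribution and enters only
through the pairing. -/
theorem _root_.HigherGauge.HasTwoJet.act {u : V → G} {u' : V → H} {p v w : V} {α β γ : 𝔤}
    {α' β' γ' : 𝔥} (h : HasTwoJet u p v w α β γ) (h' : HasTwoJet u' p v w α' β' γ') :
    HasTwoJet (fun q => X.m (u q) (u' q)) p v w α' β'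
      (γ' + X.actPairing α β' + X.actPairing β α') := by
  have := HasTwoJet.binary (M := fun (a : G) (A : H) => X.m a A) X.contMDiff_m (by simp)
    (.of_forall X.chartOp_m_one) X.eventually_chartOp_one_m h h'
  simpa using this

theorem _root_.HigherGauge.HasTwoJet.tmap {u : V → H} {p v w : V} {β γ : 𝔥}
    (h : HasTwoJet u p v w 0 β γ) :
    HasTwoJet (fun q => X.t (u q)) p v w 0 (X.tdot β) (X.tdot γ) :=
  h.map X.contMDiff_t.contMDiffAt (map_one _)

omit [LieGroup 𝓘(ℝ, 𝔤) ∞ G] in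
theorem _root_.HigherGauge.HasTwoJet.mmap (k : G) {u : V → H} {p v w : V} {β γ : 𝔥}
    (h : HasTwoJet u p v w 0 β γ) :
    HasTwoJet (fun q => X.m k (u q)) p v w 0 (X.mdot k β) (X.mdot k γ) :=
  h.map (X.contMDiff_m_apply k).contMDiffAt (map_one _)

omit [LieGroup 𝓘(ℝ, 𝔤) ∞ G] [LieGroup 𝓘(ℝ, 𝔥) ∞ H] in
theorem mdot_eq_fderiv (a : G) :
    X.mdot a = fderiv ℝ (fun z => chartOne 𝔥 H (X.m a ((chartOne 𝔥 H).symm z)))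
      (baseOne 𝔥 H) :=
  modelDeriv_one_eq_fderiv ((X.contMDiff_m_apply a).mdifferentiableAt (by simp)) (map_one _)

omit [LieGroup 𝓘(ℝ, 𝔤) ∞ G] in
theorem mdot_mul (a b : G) (Y : 𝔥) : X.mdot (a * b) Y = X.mdot a (X.mdot b Y) := by
  obtain ⟨u, hu, h1, rfl⟩ := exists_curve H Y
  have hj := HasTwoJet.comp_snd (p := (0, 0)) hu h1
  exact ((hj.mmap X (a * b)).unique
    (((hj.mmap X b).mmap X a).congr_fun' (by simp [MulAut.mul_apply]))).2.1

theorem Ad_tdot (k : G) (Y : 𝔥) : Ad k (X.tdot Y) = X.tdot (X.mdot k Y) := by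
  obtain ⟨u, hu, h1, rfl⟩ := exists_curve H Y
  have hj := HasTwoJet.comp_snd (p := (0, 0)) hu h1
  exact (((hj.tmap X).conj k).unique
    (((hj.mmap X k).tmap X).congr_fun' (by simp [X.t_m]))).2.1

/-- Mixed derivative of `m(k a k⁻¹)(m(k)(A)) = m(k)(m(a)(A))` along curves through 1 with velocities
`x` and `Y`. -/
theorem actPairing_Ad_mdot (k : G) (x : 𝔤) (Y : 𝔥) :
    X.actPairing (Ad k x) (X.mdot k Y) = X.mdot k (X.actPairing x Y) := by
  obtain ⟨u, hu, h1, rfl⟩ := exists_curve G x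
  obtain ⟨v, hv, h2, rfl⟩ := exists_curve H Y
  have hj := HasTwoJet.comp_fst (p := (0, 0)) hu h1
  have hj' := HasTwoJet.comp_snd (p := (0, 0)) hv h2
  -- Conjugation of jets needs the zero velocity in the first slot, while `hj` has it in the second;
  -- hence the two exchanges of directions.
  have e1 := (hj.symm.conj k).symm.act X (hj'.mmap X k)
  have e2 := (hj.act X hj').mmap X k
  have := (e1.unique (e2.congr_fun' (by ext q; simp [MulAut.mul_apply]))).2.2
  simpa using this

/-- Mixed derivative of the Peiffer identity `m(t(A))(B) = A B A⁻¹`. -/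
theorem actPairing_tdot (Q P : 𝔥) : X.actPairing (X.tdot Q) P = bracket H Q P := by
  obtain ⟨u, hu, h1, rfl⟩ := exists_curve H Q
  obtain ⟨v, hv, h2, rfl⟩ := exists_curve H P
  have hj := HasTwoJet.comp_fst (p := (0, 0)) hu h1
  have hj' := HasTwoJet.comp_snd (p := (0, 0)) hv h2
  have e1 := (hj.symm.tmap X).symm.act X hj'
  have e2 := (hj.mul hj').mul hj.inv
  have := (e1.unique (e2.congr_fun' (by ext q; simp [X.m_t]))).2.2
  rw [bracket_eq_mulPairing]
  simpa [sub_eq_add_neg] using this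

/-- The derivative of a field of vectors `ṁ(l) P` at a point where `l` takes the value `1`. -/
theorem hasFDerivAt_mdot_of_eq_one {l : V → G} {P : V → 𝔥} {P' : V →L[ℝ] 𝔥} {p : V}
    (hl : ContMDiffAt 𝓘(ℝ, V) 𝓘(ℝ, 𝔤) ∞ l p) (h1 : l p = 1) (hP : HasFDerivAt P P' p) :
    HasFDerivAt (fun q => X.mdot (l q) (P q))
      ((X.actPairing.comp (modelDeriv V 𝔤 l p)).flip (P p) + P') p := by
  have hc := contDiffAt_chartOp (E := 𝔥) X.contMDiff_m (M := fun (a : G) (A : H) => X.m a A)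
    (by simp)
  obtain ⟨f1, -⟩ := fderiv_fderiv_of_affine hc (.of_forall X.chartOp_m_one)
    X.eventually_chartOp_one_m
  have hl' := contDiffAt_chartOne hl h1
  have hld : HasFDerivAt (fun q => chartOne 𝔤 G (l q)) (modelDeriv V 𝔤 l p) p := by
    rw [modelDeriv_eq_fderiv (hl.mdifferentiableAt (by simp)) h1]
    exact (hl'.differentiableAt (by simp)).hasFDerivAt
  have hlp : chartOne 𝔤 G (l p) = baseOne 𝔤 G := by rw [h1]
  have h := hasFDerivAt_fderiv_inr hc hld hlp hP
  have hev : (fun q => X.mdot (l q) (P q)) =ᶠ[𝓝 p] fun q =>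
      fderiv ℝ (chartOp (E := 𝔥) fun (a : G) (A : H) => X.m a A)
        (chartOne 𝔤 G (l q), baseOne 𝔥 H) (0, P q) := by
    have ht : Tendsto (fun q => (chartOne 𝔤 G (l q), baseOne 𝔥 H)) (𝓝 p)
        (𝓝 (baseOne 𝔤 G, baseOne 𝔥 H)) := by
      rw [← hlp]
      exact (hl'.continuousAt.prodMk continuousAt_const)
    filter_upwards [eventually_chartOne_symm (E := 𝔤) hl.continuousAt h1,
      ht.eventually (eventually_differentiableAt hc)] with q hq hd
    have h3 := hd.hasFDerivAt.comp (baseOne 𝔥 H)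
      (hasFDerivAt_prodMk_right (𝕜 := ℝ) (chartOne 𝔤 G (l q)) (baseOne 𝔥 H))
    -- Freezing the `G` variable identifies `ṁ(l q)` with a partial derivative of the action in
    -- coordinates.
    have h4 : (chartOp (E := 𝔥) fun (a : G) (A : H) => X.m a A) ∘ Prod.mk (chartOne 𝔤 G (l q)) =
        fun z => chartOne 𝔥 H (X.m (l q) ((chartOne 𝔥 H).symm z)) := by
      ext z
      simp only [chartOp, Function.comp, hq]
    rw [h4] at h3
    rw [mdot_eq_fderiv, h3.fderiv]
    simp
  refine (h.congr_of_eventuallyEq hev).congr_fderiv ?_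
  ext v
  simp [f1, pairing_apply]

/-- Take for `l` the inverse chart and for `P` the constant `Y`, then compose with the chart; both
charts have identity differential at the base point. -/
theorem mhat_eq_actPairing (x : 𝔤) (Y : 𝔥) : X.mhat x Y = X.actPairing x Y := by
  have hs := contMDiffAt_chartOne_symm 𝔤 G
  have h0 := chartOne_symm_baseOne 𝔤 G
  have h := X.hasFDerivAt_mdot_of_eq_one hs h0 (hasFDerivAt_const Y (baseOne 𝔤 G))
  have hch : HasMFDerivAt 𝓘(ℝ, 𝔤) 𝓘(ℝ, 𝔤) (chartOne 𝔤 G) (1 : G) (ContinuousLinearMap.id ℝ 𝔤) := by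
    have := (mdifferentiableAt_extChartAt (I := 𝓘(ℝ, 𝔤)) (mem_chart_source 𝔤 (1 : G))).hasMFDerivAt
    rwa [mfderiv_extChartAt_self] at this
  have hd : modelDeriv 𝔤 𝔤 (chartOne 𝔤 G).symm (baseOne 𝔤 G) = ContinuousLinearMap.id ℝ 𝔤 := by
    rw [modelDeriv_eq_fderiv (hs.mdifferentiableAt (by simp)) h0]
    have : (fun z => chartOne 𝔤 G ((chartOne 𝔤 G).symm z)) =ᶠ[𝓝 (baseOne 𝔤 G)] id :=
      eventually_chartOne_right_inv 𝔤 G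
    rw [this.fderiv_eq, fderiv_id]
  have hcomp := h.hasMFDerivAt.comp (1 : G) hch
  have hev : (fun a : G => X.mdot a Y) =ᶠ[𝓝 1]
      (fun z => X.mdot ((chartOne 𝔤 G).symm z) Y) ∘ chartOne 𝔤 G := by
    filter_upwards [eventually_chartOne_symm (E := 𝔤) (u := (id : G → G)) continuousAt_id rfl]
      with a ha
    simp only [Function.comp]
    rw [id] at ha
    rw [ha]
  have := (hcomp.congr_of_eventuallyEq hev).mfderiv
  have h2 : X.mhat x Y = _ := DFunLike.congr_fun this x
  rw [h2, hd, add_zero]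
  rfl

end LieCrossedModule
end CrossedModule

/-! ### Forms on the plane in terms of their coefficients. -/

section FormCalculus

variable {V W U : Type*} [NormedAddCommGroup V] [NormedSpace ℝ V]
  [NormedAddCommGroup W] [NormedSpace ℝ W] [NormedAddCommGroup U] [NormedSpace ℝ U]

theorem Form.ext_one {η η' : Form 1 V} (hx : ∀ p, η p ![(1, 0)] = η' p ![(1, 0)])
    (hy : ∀ p, η p ![(0, 1)] = η' p ![(0, 1)]) : η = η' := by
  ext1 p
  apply ContinuousAlternatingMap.toAlternatingMap_injective
  refine Module.Basis.ext_alternating (Module.Basis.finTwoProd ℝ) fun v _ => ?_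
  have hv : (fun i => Module.Basis.finTwoProd ℝ (v i)) = ![Module.Basis.finTwoProd ℝ (v 0)] := by
    ext1 i; fin_cases i; rfl
  rw [hv]
  generalize v 0 = j
  fin_cases j
  · simpa using hx p
  · simpa using hy p

theorem Form.ext_two {η η' : Form 2 V}
    (h : ∀ p, η p ![(1, 0), (0, 1)] = η' p ![(1, 0), (0, 1)]) : η = η' := by
  ext1 p
  apply ContinuousAlternatingMap.toAlternatingMap_injective
  refine Module.Basis.ext_alternating (Module.Basis.finTwoProd ℝ) fun v hv => ?_
  have key : ∀ ζ : (ℝ × ℝ) [⋀^Fin 2]→L[ℝ] V, ζ ![(0, 1), (1, 0)] = -ζ ![(1, 0), (0, 1)] := by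
    intro ζ
    have := ζ.toAlternatingMap.map_swap ![(1, 0), (0, 1)] (i := 0) (j := 1) (by decide)
    simp only [ContinuousAlternatingMap.coe_toAlternatingMap] at this
    rw [← this]
    congr 1
    ext i <;> fin_cases i <;> simp
  have hv' : (fun i => Module.Basis.finTwoProd ℝ (v i)) =
      ![Module.Basis.finTwoProd ℝ (v 0), Module.Basis.finTwoProd ℝ (v 1)] := by
    ext1 i; fin_cases i <;> rfl
  have hne : v 0 ≠ v 1 := fun e => absurd (hv e) (by decide)
  rw [hv']
  generalize v 0 = j at hne
  generalize v 1 = k at hne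
  fin_cases j <;> fin_cases k
  · simp at hne
  · simpa using h p
  · simpa [key] using h p
  · simp at hne

/-- Finite dimension makes the linear assembly map continuous, so regularity of the form reduces to
that of its coefficients. -/
theorem exists_oneForm_eq [FiniteDimensional ℝ V] :
    ∃ L : V × V →L[ℝ] (ℝ × ℝ) [⋀^Fin 1]→L[ℝ] V,
      ∀ αx αy : ℝ × ℝ → V, oneForm αx αy = fun p => L (αx p, αy p) := by
  let L : V × V →ₗ[ℝ] (ℝ × ℝ) [⋀^Fin 1]→L[ℝ] V :=
    { toFun := fun v => ContinuousAlternatingMap.ofSubsingleton ℝ (ℝ × ℝ) V (0 : Fin 1)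
        ((ContinuousLinearMap.fst ℝ ℝ ℝ).smulRight v.1 +
          (ContinuousLinearMap.snd ℝ ℝ ℝ).smulRight v.2)
      map_add' := fun v w => by ext u; simp; abel
      map_smul' := fun c v => by ext u; simp [smul_comm c] }
  exact ⟨L.toContinuousLinearMap, fun _ _ => rfl⟩

theorem contDiff_oneForm [FiniteDimensional ℝ V] {n : WithTop ℕ∞} {αx αy : ℝ × ℝ → V}
    (hx : ContDiff ℝ n αx) (hy : ContDiff ℝ n αy) : ContDiff ℝ n (oneForm αx αy) := by
  obtain ⟨L, hL⟩ := exists_oneForm_eq (V := V)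
  rw [hL]
  exact L.contDiff.comp (hx.prodMk hy)

theorem contDiff_twoForm [FiniteDimensional ℝ V] {n : WithTop ℕ∞} {β : ℝ × ℝ → V}
    (hβ : ContDiff ℝ n β) : ContDiff ℝ n (twoForm β) := by
  let L : V →ₗ[ℝ] (ℝ × ℝ) [⋀^Fin 2]→L[ℝ] V :=
    { toFun := fun v => (ContinuousLinearMap.toSpanSingleton ℝ v).compContinuousAlternatingMap dxdy
      map_add' := fun v w => by ext u; simp
      map_smul' := fun c v => by ext u; simp [smul_comm c] }
  exact L.toContinuousLinearMap.contDiff.comp hβ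

theorem oneForm_apply_fst (αx αy : ℝ × ℝ → V) (p : ℝ × ℝ) :
    oneForm αx αy p ![(1, 0)] = αx p := by simp [oneForm_apply]

theorem oneForm_apply_snd (αx αy : ℝ × ℝ → V) (p : ℝ × ℝ) :
    oneForm αx αy p ![(0, 1)] = αy p := by simp [oneForm_apply]

theorem toForm_apply (α : ℝ × ℝ → (ℝ × ℝ →L[ℝ] V)) (p u : ℝ × ℝ) :
    toForm α p ![u] = α p u := by simp [toForm]

theorem twoForm_apply_basis (β : ℝ × ℝ → V) (p : ℝ × ℝ) :
    twoForm β p ![(1, 0), (0, 1)] = β p := by simp [twoForm_apply]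

theorem mapForm_apply {k : ℕ} (L : ℝ × ℝ → (V →L[ℝ] W)) (η : Form k V) (p : ℝ × ℝ)
    (u : Fin k → ℝ × ℝ) : mapForm L η p u = L p (η p u) := rfl

theorem wedge_apply_basis (b : V → W → U) (α : Form 1 V) (β : Form 1 W) (p : ℝ × ℝ) :
    wedge b α β p ![(1, 0), (0, 1)] =
      b (α p ![(1, 0)]) (β p ![(0, 1)]) - b (α p ![(0, 1)]) (β p ![(1, 0)]) := by
  rw [wedge, twoForm_apply_basis]

theorem extDeriv_oneForm_apply_basis [FiniteDimensional ℝ V] {αx αy : ℝ × ℝ → V}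
    {p : ℝ × ℝ} (hx : DifferentiableAt ℝ αx p) (hy : DifferentiableAt ℝ αy p) :
    extDeriv (oneForm αx αy) p ![(1, 0), (0, 1)] =
      fderiv ℝ αy p (1, 0) - fderiv ℝ αx p (0, 1) := by
  have hd : DifferentiableAt ℝ (oneForm αx αy) p := by
    obtain ⟨L, hL⟩ := exists_oneForm_eq (V := V)
    rw [hL]
    exact L.differentiableAt.comp p (hx.prodMk hy)
  rw [extDeriv_apply hd, Fin.sum_univ_two]
  have e0 : (0 : Fin 2).removeNth ![((1 : ℝ), (0 : ℝ)), (0, 1)] = ![(0, 1)] := by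
    ext i <;> fin_cases i <;> rfl
  have e1 : (1 : Fin 2).removeNth ![((1 : ℝ), (0 : ℝ)), (0, 1)] = ![(1, 0)] := by
    ext i <;> fin_cases i <;> rfl
  rw [e0, e1]
  simp only [oneForm_apply_fst, oneForm_apply_snd]
  simp [sub_eq_add_neg]

end FormCalculus

/-! ### Maps equal to 1 along a line or a diagonal. -/

section Diagonal

variable {V₀ E N : Type*} [NormedAddCommGroup V₀] [NormedSpace ℝ V₀]
  [NormedAddCommGroup E] [NormedSpace ℝ E] [TopologicalSpace N] [ChartedSpace E N] [Group N]

theorem rightLog_of_eq_one {V : Type*} [NormedAddCommGroup V] [NormedSpace ℝ V] {F : V → N} {p : V}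
    (h : F p = 1) : rightLog F p = modelDeriv V E F p := by
  have : (fun q => F q * (F p)⁻¹) = F := by simp [h]
  change modelDeriv V E (fun q => F q * (F p)⁻¹) p = _
  rw [this]

theorem leftLog_of_eq_one {V : Type*} [NormedAddCommGroup V] [NormedSpace ℝ V] {F : V → N} {p : V}
    (h : F p = 1) : leftLog F p = modelDeriv V E F p := by
  have : (fun q => (F p)⁻¹ * F q) = F := by simp [h]
  change modelDeriv V E (fun q => (F p)⁻¹ * F q) p = _
  rw [this]

variable [IsManifold 𝓘(ℝ, E) ∞ N]

theorem modelDeriv_comp_of_eq_one {V : Type*} [NormedAddCommGroup V] [NormedSpace ℝ V]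
    {F : V₀ → N} (hF : ContMDiff 𝓘(ℝ, V₀) 𝓘(ℝ, E) ∞ F) {c : V → V₀} {c' : V →L[ℝ] V₀} {s : V}
    (hc : HasFDerivAt c c' s) (h1 : F (c s) = 1) :
    modelDeriv V E (fun r => F (c r)) s = (modelDeriv V₀ E F (c s)).comp c' := by
  have hd := contDiffAt_chartOne hF.contMDiffAt h1
  have hm := hF.contMDiffAt.mdifferentiableAt (x := c s) (by simp)
  have hm' : MDifferentiableAt 𝓘(ℝ, V) 𝓘(ℝ, E) (fun r => F (c r)) s :=
    hm.comp s hc.differentiableAt.mdifferentiableAt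
  rw [modelDeriv_eq_fderiv hm h1, modelDeriv_eq_fderiv hm' h1]
  exact ((hd.differentiableAt (by simp)).hasFDerivAt.comp s hc).fderiv

/-- The velocities of smooth curves issuing from `1` and depending smoothly on parameters. -/
theorem contDiff_modelDeriv {F : V₀ → N} (hF : ContMDiff 𝓘(ℝ, V₀) 𝓘(ℝ, E) ∞ F)
    {c : ℝ × ℝ → ℝ → V₀} {e : V₀} {s : ℝ × ℝ → ℝ}
    (hs : ContDiff ℝ ∞ fun p => c p (s p)) (hc : ∀ p, HasDerivAt (c p) e (s p))
    (h1 : ∀ p, F (c p (s p)) = 1) :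
    ContDiff ℝ ∞ fun p => modelDeriv ℝ E (fun r => F (c p r)) (s p) 1 := by
  -- The moving curve is absorbed in a directional derivative of the fixed map `F` at a moving
  -- point. The chart at 1 suffices, since `F` equals 1 at all these points.
  have : (fun p => modelDeriv ℝ E (fun r => F (c p r)) (s p) 1) =
      fun p => fderiv ℝ (fun z => chartOne E N (F z)) (c p (s p)) e := by
    ext1 p
    rw [modelDeriv_comp_of_eq_one hF (hc p).hasFDerivAt (h1 p),
      modelDeriv_eq_fderiv (hF.contMDiffAt.mdifferentiableAt (by simp)) (h1 p)]
    simp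
  rw [this, contDiff_iff_contDiffAt]
  intro p
  have hd := (contDiffAt_chartOne hF.contMDiffAt (h1 p)).fderiv_right (m := ∞) (by norm_cast)
  exact (hd.comp p hs.contDiffAt).clm_apply contDiffAt_const

theorem contDiff_fderiv_fderiv_chartOne {F : V₀ → N} (hF : ContMDiff 𝓘(ℝ, V₀) 𝓘(ℝ, E) ∞ F)
    {c : ℝ × ℝ → V₀} (hc : ContDiff ℝ ∞ c) (h1 : ∀ p, F (c p) = 1) (e e' : V₀) :
    ContDiff ℝ ∞ fun p => fderiv ℝ (fderiv ℝ fun z => chartOne E N (F z)) (c p) e e' := by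
  rw [contDiff_iff_contDiffAt]
  intro p
  have hd := ((contDiffAt_chartOne hF.contMDiffAt (h1 p)).fderiv_right (m := ∞)
    (by norm_cast)).fderiv_right (m := ∞) (by norm_cast)
  exact ((hd.comp p hc.contDiffAt).clm_apply contDiffAt_const).clm_apply contDiffAt_const

/-- The two-jet of a map on the plane which is `1` on a horizontal line. -/
theorem HasTwoJet.of_eq_one_fst {K : ℝ × ℝ → N} (hK : ContMDiff 𝓘(ℝ, ℝ × ℝ) 𝓘(ℝ, E) ∞ K)
    {p : ℝ × ℝ} (h1 : ∀ s, K (s, p.2) = 1) :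
    HasTwoJet K p (1, 0) (0, 1) 0 (modelDeriv ℝ E (fun r => K (p.1, r)) p.2 1)
      (deriv (fun s => modelDeriv ℝ E (fun r => K (s, r)) p.2 1) p.1) := by
  have hd := contDiffAt_chartOne hK.contMDiffAt (h1 p.1)
  have hline : ∀ s, MDifferentiableAt 𝓘(ℝ, ℝ) 𝓘(ℝ, E) (fun r => K (s, r)) p.2 := fun s =>
    (hK.contMDiffAt.mdifferentiableAt (by simp)).comp p.2
      (hasFDerivAt_prodMk_right (𝕜 := ℝ) s p.2).differentiableAt.mdifferentiableAt
  have hdf := (hd.differentiableAt (by simp)).hasFDerivAt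
  refine ⟨hK.contMDiffAt, h1 p.1, ?_, ?_, ?_⟩
  · have := (hdf.comp p.1 (hasFDerivAt_prodMk_left (𝕜 := ℝ) p.1 p.2)).fderiv
    simp only [Function.comp_def, h1] at this
    simpa using (DFunLike.congr_fun this 1).symm
  · have := (hdf.comp p.2 (hasFDerivAt_prodMk_right (𝕜 := ℝ) p.1 p.2)).fderiv
    rw [modelDeriv_eq_fderiv (hline p.1) (h1 p.1)]
    simpa [Function.comp_def] using (DFunLike.congr_fun this 1).symm
  · rw [← deriv_fderiv_snd hd]
    congr 1
    ext1 s
    rw [modelDeriv_eq_fderiv (hline s) (h1 s)]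

/-- The two-jet of a map on the plane which is `1` on a vertical line. -/
theorem HasTwoJet.of_eq_one_snd {K : ℝ × ℝ → N} (hK : ContMDiff 𝓘(ℝ, ℝ × ℝ) 𝓘(ℝ, E) ∞ K)
    {p : ℝ × ℝ} (h1 : ∀ r, K (p.1, r) = 1) :
    HasTwoJet K p (1, 0) (0, 1) (modelDeriv ℝ E (fun s => K (s, p.2)) p.1 1) 0
      (deriv (fun r => modelDeriv ℝ E (fun s => K (s, r)) p.1 1) p.2) := by
  have hd := contDiffAt_chartOne hK.contMDiffAt (h1 p.2)
  have hline : ∀ r, MDifferentiableAt 𝓘(ℝ, ℝ) 𝓘(ℝ, E) (fun s => K (s, r)) p.1 := fun r =>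
    (hK.contMDiffAt.mdifferentiableAt (by simp)).comp p.1
      (hasFDerivAt_prodMk_left (𝕜 := ℝ) p.1 r).differentiableAt.mdifferentiableAt
  have hdf := (hd.differentiableAt (by simp)).hasFDerivAt
  refine ⟨hK.contMDiffAt, h1 p.2, ?_, ?_, ?_⟩
  · have := (hdf.comp p.1 (hasFDerivAt_prodMk_left (𝕜 := ℝ) p.1 p.2)).fderiv
    rw [modelDeriv_eq_fderiv (hline p.2) (h1 p.2)]
    simpa [Function.comp_def] using (DFunLike.congr_fun this 1).symm
  · have := (hdf.comp p.2 (hasFDerivAt_prodMk_right (𝕜 := ℝ) p.1 p.2)).fderiv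
    simp only [Function.comp_def, h1] at this
    simpa using (DFunLike.congr_fun this 1).symm
  · rw [fderiv_fderiv_comm hd, ← deriv_fderiv_fst hd]
    congr 1
    ext1 r
    rw [modelDeriv_eq_fderiv (hline r) (h1 r)]

omit [IsManifold 𝓘(ℝ, E) ∞ N] in
/-- A curve issuing from `1`, as a two-jet. -/
theorem HasTwoJet.of_curve {u : ℝ → N} {s : ℝ} (hu : ContMDiffAt 𝓘(ℝ, ℝ) 𝓘(ℝ, E) ∞ u s)
    (h1 : u s = 1) : HasTwoJet u s 0 1 0 (modelDeriv ℝ E u s 1) 0 := by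
  rw [modelDeriv_eq_fderiv (hu.mdifferentiableAt (by simp)) h1]
  exact ⟨hu, h1, by simp, rfl, by simp⟩

end Diagonal

/-! ### The forms of a cocycle and the vanishing of its fake curvature. -/

section CocycleForms

variable {𝔤 𝔥 G H : Type*}
  [NormedAddCommGroup 𝔤] [NormedSpace ℝ 𝔤] [NormedAddCommGroup 𝔥] [NormedSpace ℝ 𝔥]
  [TopologicalSpace G] [ChartedSpace 𝔤 G] [Group G]
  [TopologicalSpace H] [ChartedSpace 𝔥 H] [Group H]
  {X : LieCrossedModule 𝔤 𝔥 G H}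

section Velocity

variable {E N : Type*} [NormedAddCommGroup E] [NormedSpace ℝ E] [TopologicalSpace N]
  [ChartedSpace E N]

variable (E) in
/-- The velocity `∂_{x'} F(x', x; y)` at `x' = x`. -/
def velocityFst (F : ℝ → ℝ → ℝ → N) (p : ℝ × ℝ) : E :=
  modelDeriv ℝ E (fun s => F s p.1 p.2) p.1 1

variable (E) in
/-- The velocity `∂_{y'} F(x; y', y)` at `y' = y`. -/
def velocitySnd (F : ℝ → ℝ → ℝ → N) (p : ℝ × ℝ) : E :=
  modelDeriv ℝ E (fun r => F p.1 r p.2) p.2 1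

variable [Group N] [IsManifold 𝓘(ℝ, E) ∞ N] {F : ℝ → ℝ → ℝ → N}

theorem contDiff_velocityFst
    (hF : ContMDiff 𝓘(ℝ, ℝ × ℝ × ℝ) 𝓘(ℝ, E) ∞ fun p : ℝ × ℝ × ℝ => F p.1 p.2.1 p.2.2)
    (h1 : ∀ x y, F x x y = 1) : ContDiff ℝ ∞ (velocityFst E F) :=
  contDiff_modelDeriv (F := fun p : ℝ × ℝ × ℝ => F p.1 p.2.1 p.2.2) hF
    (c := fun p s => (s, p.1, p.2)) (s := Prod.fst) (e := (1, 0)) (by fun_prop)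
    (fun p => (hasDerivAt_id p.1).prodMk (hasDerivAt_const p.1 (p.1, p.2)))
    (fun p => h1 p.1 p.2)

theorem contDiff_velocitySnd
    (hF : ContMDiff 𝓘(ℝ, ℝ × ℝ × ℝ) 𝓘(ℝ, E) ∞ fun p : ℝ × ℝ × ℝ => F p.1 p.2.1 p.2.2)
    (h1 : ∀ x y, F x y y = 1) : ContDiff ℝ ∞ (velocitySnd E F) :=
  contDiff_modelDeriv (F := fun p : ℝ × ℝ × ℝ => F p.1 p.2.1 p.2.2) hF
    (c := fun p s => (p.1, s, p.2)) (s := Prod.snd) (e := (0, 1, 0)) (by fun_prop)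
    (fun p => (hasDerivAt_const p.2 p.1).prodMk
      ((hasDerivAt_id p.2).prodMk (hasDerivAt_const p.2 p.2)))
    (fun p => h1 p.1 p.2)

theorem deriv_line_fst {α : ℝ × ℝ → E} (hα : ContDiff ℝ ∞ α) (p : ℝ × ℝ) :
    deriv (fun s => α (s, p.2)) p.1 = fderiv ℝ α p (1, 0) := by
  have h := (hα.contDiffAt.differentiableAt (x := p) (by simp)).hasFDerivAt.comp p.1
    (hasFDerivAt_prodMk_left (𝕜 := ℝ) p.1 p.2)
  simpa [Function.comp_def] using h.hasDerivAt.deriv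

theorem deriv_line_snd {α : ℝ × ℝ → E} (hα : ContDiff ℝ ∞ α) (p : ℝ × ℝ) :
    deriv (fun r => α (p.1, r)) p.2 = fderiv ℝ α p (0, 1) := by
  have h := (hα.contDiffAt.differentiableAt (x := p) (by simp)).hasFDerivAt.comp p.2
    (hasFDerivAt_prodMk_right (𝕜 := ℝ) p.1 p.2)
  simpa [Function.comp_def] using h.hasDerivAt.deriv

/-- The two-jet of `(x', y) ↦ F(x', x; y)`. -/
theorem hasTwoJet_triple_fst
    (hF : ContMDiff 𝓘(ℝ, ℝ × ℝ × ℝ) 𝓘(ℝ, E) ∞ fun p : ℝ × ℝ × ℝ => F p.1 p.2.1 p.2.2)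
    (h1 : ∀ x y, F x x y = 1) (p : ℝ × ℝ) :
    HasTwoJet (fun q : ℝ × ℝ => F q.1 p.1 q.2) p (1, 0) (0, 1) (velocityFst E F p) 0
      (fderiv ℝ (velocityFst E F) p (0, 1)) := by
  have hK := GaugeTransformation.contMDiff_triple hF (V := ℝ × ℝ) contDiff_fst
    (contDiff_const (c := p.1)) contDiff_snd
  have h := HasTwoJet.of_eq_one_snd hK (p := p) (fun r => h1 _ _)
  rw [← deriv_line_snd (contDiff_velocityFst hF h1)]
  exact h

/-- The two-jet of `(x, y') ↦ F(x; y', y)`. -/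
theorem hasTwoJet_triple_snd
    (hF : ContMDiff 𝓘(ℝ, ℝ × ℝ × ℝ) 𝓘(ℝ, E) ∞ fun p : ℝ × ℝ × ℝ => F p.1 p.2.1 p.2.2)
    (h1 : ∀ x y, F x y y = 1) (p : ℝ × ℝ) :
    HasTwoJet (fun q : ℝ × ℝ => F q.1 q.2 p.2) p (1, 0) (0, 1) 0 (velocitySnd E F p)
      (fderiv ℝ (velocitySnd E F) p (1, 0)) := by
  have hK := GaugeTransformation.contMDiff_triple hF (V := ℝ × ℝ) contDiff_fst
    contDiff_snd (contDiff_const (c := p.2))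
  have h := HasTwoJet.of_eq_one_fst hK (p := p) (fun r => h1 _ _)
  rw [← deriv_line_fst (contDiff_velocitySnd hF h1)]
  exact h

end Velocity

namespace Cocycle

variable (C : Cocycle X)

/-- At coincident arguments the composition law says that the value is idempotent. -/
theorem f_self (x y : ℝ) : C.f x x y = 1 := by
  simpa using C.f_comp x x x y

theorem g_self (x y : ℝ) : C.g x y y = 1 := by
  simpa using C.g_comp x y y y

theorem W_self_x (x y' y : ℝ) : C.W x x y' y = 1 := by
  simpa [C.f_self] using C.W_comp_x x x x y' y

theorem W_self_y (x' x y : ℝ) : C.W x' x y y = 1 := by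
  simpa [C.g_self] using C.W_comp_y x' x y y y

theorem a_eq : C.a = oneForm (fun p => -velocityFst 𝔤 C.f p) fun p => -velocitySnd 𝔤 C.g p := by
  unfold Cocycle.a
  congr 1
  · ext1 p
    rw [rightLog_of_eq_one (F := fun x' => C.f x' p.1 p.2) (C.f_self _ _)]
    rfl
  · ext1 p
    rw [rightLog_of_eq_one (F := fun y' => C.g p.1 y' p.2) (C.g_self _ _)]
    rfl

/-- The mixed derivative `∂_{x'} ∂_{y'} W(x', x; y', y)` at `x' = x`, `y' = y`. -/
def WMixed (p : ℝ × ℝ) : 𝔥 :=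
  deriv (fun s => modelDeriv ℝ 𝔥 (fun r => C.W s p.1 r p.2) p.2 1) p.1

theorem B_eq : C.B = twoForm fun p => -C.WMixed p := by
  unfold Cocycle.B
  congr 1
  ext1 p
  congr 2
  ext1 s
  rw [rightLog_of_eq_one (F := fun y' => C.W s p.1 y' p.2) (C.W_self_y _ _ _)]

theorem contMDiff_W_plane (p : ℝ × ℝ) :
    ContMDiff 𝓘(ℝ, ℝ × ℝ) 𝓘(ℝ, 𝔥) ∞ fun q : ℝ × ℝ => C.W q.1 p.1 q.2 p.2 := by
  have : ContDiff ℝ ∞ fun q : ℝ × ℝ => (q.1, p.1, q.2, p.2) := by fun_prop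
  exact C.contMDiff_W.comp this.contMDiff

theorem contMDiff_f_line (p : ℝ × ℝ) :
    ContMDiff 𝓘(ℝ, ℝ) 𝓘(ℝ, 𝔤) ∞ fun s => C.f s p.1 p.2 :=
  GaugeTransformation.contMDiff_triple C.contMDiff_f contDiff_id contDiff_const contDiff_const

theorem contMDiff_g_line (p : ℝ × ℝ) :
    ContMDiff 𝓘(ℝ, ℝ) 𝓘(ℝ, 𝔤) ∞ fun r => C.g p.1 r p.2 :=
  GaugeTransformation.contMDiff_triple C.contMDiff_g contDiff_const contDiff_id contDiff_const

variable [LieGroup 𝓘(ℝ, 𝔤) ∞ G] [LieGroup 𝓘(ℝ, 𝔥) ∞ H]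

omit [LieGroup 𝓘(ℝ, 𝔤) ∞ G] in
-- `W` equals 1 on both the line `x' = x` and the line `y' = y`, so both first derivatives vanish
-- and the mixed one is a genuine element of `𝔥`.
theorem hasTwoJet_W (p : ℝ × ℝ) :
    HasTwoJet (fun q : ℝ × ℝ => C.W q.1 p.1 q.2 p.2) p (1, 0) (0, 1) 0 0 (C.WMixed p) := by
  have h := HasTwoJet.of_eq_one_fst (C.contMDiff_W_plane p) (p := p) (fun s => C.W_self_y _ _ _)
  have h0 := (HasTwoJet.of_eq_one_snd (C.contMDiff_W_plane p) (p := p)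
    (fun s => C.W_self_x _ _ _))
  rw [(h.unique h0).2.1] at h
  exact h

omit [LieGroup 𝓘(ℝ, 𝔤) ∞ G] in
-- The iterated derivative is a second derivative of `W` on `ℝ⁴`, in the fixed directions of `x'`
-- and `y'`, evaluated along `(x, x, y, y)`, where the smooth dependence on the point is visible.
theorem contDiff_WMixed : ContDiff ℝ ∞ C.WMixed := by
  let i : ℝ × ℝ →L[ℝ] ℝ × ℝ × ℝ × ℝ := (ContinuousLinearMap.fst ℝ ℝ ℝ).prod
    ((0 : ℝ × ℝ →L[ℝ] ℝ).prod ((ContinuousLinearMap.snd ℝ ℝ ℝ).prod 0))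
  have hc : ContDiff ℝ ∞ fun p : ℝ × ℝ => (p.1, p.1, p.2, p.2) := by fun_prop
  have h := contDiff_fderiv_fderiv_chartOne C.contMDiff_W hc
    (fun p => C.W_self_x p.1 p.2 p.2) (1, 0, 0, 0) (0, 0, 1, 0)
  convert h using 1
  ext1 p
  rw [← (C.hasTwoJet_W p).mixed]
  have hd := contDiffAt_chartOne (C.contMDiff_W.contMDiffAt (x := (p.1, p.1, p.2, p.2)))
    (C.W_self_x p.1 p.2 p.2)
  have hi : ∀ q, HasFDerivAt (fun q : ℝ × ℝ => (q.1, p.1, q.2, p.2)) i q := fun q =>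
    hasFDerivAt_fst.prodMk ((hasFDerivAt_const p.1 q).prodMk
      (hasFDerivAt_snd.prodMk (hasFDerivAt_const p.2 q)))
  have hi' : ContDiffAt ℝ ∞ (fun q : ℝ × ℝ => (q.1, p.1, q.2, p.2)) p := by fun_prop
  have h2 := fderiv_fderiv_comp (U := fun q : ℝ × ℝ => (q.1, p.1, q.2, p.2)) hd hi' (1, 0) (0, 1)
  rw [funext fun q => (hi q).fderiv] at h2
  simpa [Function.comp_def, i] using h2

omit [LieGroup 𝓘(ℝ, 𝔥) ∞ H] in
/-- The two-jet of `(x', y') ↦ f(x', x; y)`. -/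
theorem hasTwoJet_f (p : ℝ × ℝ) :
    HasTwoJet (fun q : ℝ × ℝ => C.f q.1 p.1 p.2) p (1, 0) (0, 1) (velocityFst 𝔤 C.f p) 0 0 :=
  HasTwoJet.comp_fst (u := fun s => C.f s p.1 p.2) (C.contMDiff_f_line p).contMDiffAt
    (C.f_self _ _)

omit [LieGroup 𝓘(ℝ, 𝔥) ∞ H] in
/-- The two-jet of `(x', y') ↦ g(x; y', y)`. -/
theorem hasTwoJet_g (p : ℝ × ℝ) :
    HasTwoJet (fun q : ℝ × ℝ => C.g p.1 q.2 p.2) p (1, 0) (0, 1) 0 (velocitySnd 𝔤 C.g p) 0 :=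
  HasTwoJet.comp_snd (u := fun r => C.g p.1 r p.2) (C.contMDiff_g_line p).contMDiffAt
    (C.g_self _ _)

omit [LieGroup 𝓘(ℝ, 𝔥) ∞ H] in
theorem contDiff_velocityFst_f : ContDiff ℝ ∞ (velocityFst 𝔤 C.f) :=
  contDiff_velocityFst C.contMDiff_f C.f_self

omit [LieGroup 𝓘(ℝ, 𝔥) ∞ H] in
theorem contDiff_velocitySnd_g : ContDiff ℝ ∞ (velocitySnd 𝔤 C.g) :=
  contDiff_velocitySnd C.contMDiff_g C.g_self

/-- Compare the mixed components of the two sides of the target law, as functions of `(x', y')`. The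
derivatives come from `f(x', x; y')` and `g(x'; y', y)`, the bracket from the cross terms of the
product. -/
theorem tdot_WMixed (p : ℝ × ℝ) :
    X.tdot (C.WMixed p) =
      fderiv ℝ (velocitySnd 𝔤 C.g) p (1, 0) - fderiv ℝ (velocityFst 𝔤 C.f) p (0, 1) -
        bracket G (velocityFst 𝔤 C.f p) (velocitySnd 𝔤 C.g p) := by
  have h1 := (C.hasTwoJet_g p).inv
  have h2 := (hasTwoJet_triple_fst C.contMDiff_f C.f_self p).inv
  have h3 := hasTwoJet_triple_snd C.contMDiff_g C.g_self p
  have h4 := C.hasTwoJet_f p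
  have h := ((h1.mul h2).mul h3).mul h4
  have h' := ((C.hasTwoJet_W p).tmap X).congr_fun' (funext fun q => (C.target q.1 p.1 q.2 p.2).symm)
  rw [(h'.unique h).2.2, bracket_eq_mulPairing]
  simp
  abel

theorem isConnectionDoublet [FiniteDimensional ℝ 𝔤] [FiniteDimensional ℝ 𝔥] :
    IsConnectionDoublet X C.a C.B where
  contDiff_a := by
    rw [C.a_eq]
    exact contDiff_oneForm C.contDiff_velocityFst_f.neg C.contDiff_velocitySnd_g.neg
  contDiff_B := by
    rw [C.B_eq]
    exact contDiff_twoForm C.contDiff_WMixed.neg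
  fakeFlat := by
    refine Form.ext_two fun p => ?_
    have e := C.tdot_WMixed p
    rw [C.a_eq, C.B_eq]
    have hd := extDeriv_oneForm_apply_basis (p := p)
      (C.contDiff_velocityFst_f.neg.contDiffAt.differentiableAt (by simp))
      (C.contDiff_velocitySnd_g.neg.contDiffAt.differentiableAt (by simp))
    change extDeriv _ p ![(1, 0), (0, 1)] + (1 / 2 : ℝ) • wedge _ _ _ p ![(1, 0), (0, 1)] -
      mapForm _ _ p ![(1, 0), (0, 1)] = (0 : 𝔤)
    -- Expanding brackets into `mulPairing` makes their antisymmetry a linear identity, so that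
    -- `½[a, a]` collapses to one bracket.
    simp only [hd, wedge_apply_basis, mapForm_apply, twoForm_apply_basis, oneForm_apply_fst,
      oneForm_apply_snd, fderiv_fun_neg, map_neg, e, bracket_eq_mulPairing, neg_apply, neg_neg]
    module

end Cocycle

end CocycleForms

/-! ### The effect of a 1-gauge transformation on the forms. -/

section GaugeForms

variable {𝔤 𝔥 G H : Type*}
  [NormedAddCommGroup 𝔤] [NormedSpace ℝ 𝔤] [NormedAddCommGroup 𝔥] [NormedSpace ℝ 𝔥]
  [TopologicalSpace G] [ChartedSpace 𝔤 G] [Group G]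
  [TopologicalSpace H] [ChartedSpace 𝔥 H] [Group H]
  {X : LieCrossedModule 𝔤 𝔥 G H}

namespace GaugeTransformation

variable {C : Cocycle X} (T : GaugeTransformation C)

theorem Ψ_self (x y : ℝ) : T.Ψ x x y = 1 := by
  simpa [C.f_self] using T.Ψ_comp x x x y

theorem Φ_self (x y : ℝ) : T.Φ x y y = 1 := by
  simpa [C.g_self] using T.Φ_comp x y y y

theorem Γ_eq : T.Γ = oneForm (fun p => -X.mdot (T.varkappa p) (velocityFst 𝔥 T.Ψ p))
    fun p => -X.mdot (T.varkappa p) (velocitySnd 𝔥 T.Φ p) := by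
  unfold GaugeTransformation.Γ
  congr 1
  · ext1 p
    rw [leftLog_of_eq_one (F := fun x' => T.Ψ x' p.1 p.2) (T.Ψ_self _ _)]
    rfl
  · ext1 p
    rw [leftLog_of_eq_one (F := fun y' => T.Φ p.1 y' p.2) (T.Φ_self _ _)]
    rfl

theorem contMDiff_Ψ_line (p : ℝ × ℝ) :
    ContMDiff 𝓘(ℝ, ℝ) 𝓘(ℝ, 𝔥) ∞ fun s => T.Ψ s p.1 p.2 :=
  contMDiff_triple T.contMDiff_Ψ contDiff_id contDiff_const contDiff_const

theorem contMDiff_Φ_line (p : ℝ × ℝ) :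
    ContMDiff 𝓘(ℝ, ℝ) 𝓘(ℝ, 𝔥) ∞ fun r => T.Φ p.1 r p.2 :=
  contMDiff_triple T.contMDiff_Φ contDiff_const contDiff_id contDiff_const

variable [LieGroup 𝓘(ℝ, 𝔤) ∞ G] [LieGroup 𝓘(ℝ, 𝔥) ∞ H]

omit [LieGroup 𝓘(ℝ, 𝔥) ∞ H] in
theorem contMDiff_varkappa_mul_inv (p : ℝ × ℝ) :
    ContMDiff 𝓘(ℝ, ℝ × ℝ) 𝓘(ℝ, 𝔤) ∞ fun q => T.varkappa q * (T.varkappa p)⁻¹ :=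
  T.contMDiff_κ.mul contMDiff_const

omit [LieGroup 𝓘(ℝ, 𝔥) ∞ H] in
-- A first-order statement phrased as a jet with directions 0 and 1 on the line; the trivial first
-- slot makes all the jet rules applicable and free of second-order terms.
theorem hasTwoJet_varkappa_line_fst (p : ℝ × ℝ) :
    HasTwoJet (fun s => T.varkappa (s, p.2) * (T.varkappa p)⁻¹) p.1 0 1 0
      (rightLog T.varkappa p (1, 0) : 𝔤) 0 := by
  have hl := hasFDerivAt_prodMk_left (𝕜 := ℝ) p.1 p.2
  have hc : ContDiff ℝ ∞ fun s : ℝ => (s, p.2) := by fun_prop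
  have h := HasTwoJet.of_curve (E := 𝔤)
    ((T.contMDiff_varkappa_mul_inv p).comp hc.contMDiff).contMDiffAt (s := p.1)
    (mul_inv_cancel (T.varkappa p))
  have hm := modelDeriv_comp_of_eq_one (T.contMDiff_varkappa_mul_inv p) hl
    (mul_inv_cancel (T.varkappa p))
  have e : modelDeriv ℝ 𝔤 (fun s => T.varkappa (s, p.2) * (T.varkappa p)⁻¹) p.1 1 =
      (rightLog T.varkappa p (1, 0) : 𝔤) := DFunLike.congr_fun hm 1
  rw [← e]
  exact h

omit [LieGroup 𝓘(ℝ, 𝔥) ∞ H] in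
theorem hasTwoJet_varkappa_line_snd (p : ℝ × ℝ) :
    HasTwoJet (fun r => T.varkappa (p.1, r) * (T.varkappa p)⁻¹) p.2 0 1 0
      (rightLog T.varkappa p (0, 1) : 𝔤) 0 := by
  have hl := hasFDerivAt_prodMk_right (𝕜 := ℝ) p.1 p.2
  have hc : ContDiff ℝ ∞ fun r : ℝ => (p.1, r) := by fun_prop
  have h := HasTwoJet.of_curve (E := 𝔤)
    ((T.contMDiff_varkappa_mul_inv p).comp hc.contMDiff).contMDiffAt (s := p.2)
    (mul_inv_cancel (T.varkappa p))
  have hm := modelDeriv_comp_of_eq_one (T.contMDiff_varkappa_mul_inv p) hl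
    (mul_inv_cancel (T.varkappa p))
  have e : modelDeriv ℝ 𝔤 (fun r => T.varkappa (p.1, r) * (T.varkappa p)⁻¹) p.2 1 =
      (rightLog T.varkappa p (0, 1) : 𝔤) := DFunLike.congr_fun hm 1
  rw [← e]
  exact h

/-- With `κ = ϰ(p)`, `f*` factors as `(ϰ(x', y) κ⁻¹) · κ (f t(Ψ)⁻¹) κ⁻¹`, and both factors are 1 at
`x' = x`, so their velocities add. -/
theorem velocityFst_transform_f (p : ℝ × ℝ) :
    velocityFst 𝔤 T.transform.f p = rightLog T.varkappa p (1, 0) +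
      Ad (T.varkappa p) (velocityFst 𝔤 C.f p - X.tdot (velocityFst 𝔥 T.Ψ p)) := by
  have hf := HasTwoJet.of_curve (C.contMDiff_f_line p).contMDiffAt (C.f_self p.1 p.2)
  have hΨ := HasTwoJet.of_curve (T.contMDiff_Ψ_line p).contMDiffAt (T.Ψ_self p.1 p.2)
  have hw := hf.mul (hΨ.tmap X).inv
  simp only [neg_zero, add_zero, map_zero, zero_apply] at hw
  have h := (T.hasTwoJet_varkappa_line_fst p).mul (hw.conj (T.varkappa p))
  have h' := HasTwoJet.of_curve (T.transform.contMDiff_f_line p).contMDiffAt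
    (T.transform.f_self p.1 p.2)
  have e := (h'.unique (h.congr_fun' (by
    ext s
    simp only [transform, varkappa]
    group))).2.1
  rw [sub_eq_add_neg]
  exact e

theorem velocitySnd_transform_g (p : ℝ × ℝ) :
    velocitySnd 𝔤 T.transform.g p = rightLog T.varkappa p (0, 1) +
      Ad (T.varkappa p) (velocitySnd 𝔤 C.g p - X.tdot (velocitySnd 𝔥 T.Φ p)) := by
  have hg := HasTwoJet.of_curve (C.contMDiff_g_line p).contMDiffAt (C.g_self p.1 p.2)
  have hΦ := HasTwoJet.of_curve (T.contMDiff_Φ_line p).contMDiffAt (T.Φ_self p.1 p.2)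
  have hw := hg.mul (hΦ.tmap X).inv
  simp only [neg_zero, add_zero, map_zero, zero_apply] at hw
  have h := (T.hasTwoJet_varkappa_line_snd p).mul (hw.conj (T.varkappa p))
  have h' := HasTwoJet.of_curve (T.transform.contMDiff_g_line p).contMDiffAt
    (T.transform.g_self p.1 p.2)
  have e := (h'.unique (h.congr_fun' (by
    ext s
    simp only [transform, varkappa]
    group))).2.1
  rw [sub_eq_add_neg]
  exact e

theorem a_transform : T.transform.a =
    mapForm (fun p => Ad (T.varkappa p)) C.a - toForm (rightLog T.varkappa) -
      mapForm (fun _ => X.tdot) T.Γ := by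
  rw [C.a_eq, T.transform.a_eq, T.Γ_eq]
  refine Form.ext_one (fun p => ?_) fun p => ?_
  · simp only [Pi.sub_apply, ContinuousAlternatingMap.sub_apply, mapForm_apply, toForm_apply,
      oneForm_apply_fst, T.velocityFst_transform_f, map_sub, map_neg, X.Ad_tdot]
    abel
  · simp only [Pi.sub_apply, ContinuousAlternatingMap.sub_apply, mapForm_apply, toForm_apply,
      oneForm_apply_snd, T.velocitySnd_transform_g, map_sub, map_neg, X.Ad_tdot]
    abel

omit [LieGroup 𝓘(ℝ, 𝔤) ∞ G] in
/-- The two-jet of `(x', y') ↦ Ψ(x', x; y)`. -/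
theorem hasTwoJet_Ψ (p : ℝ × ℝ) :
    HasTwoJet (fun q : ℝ × ℝ => T.Ψ q.1 p.1 p.2) p (1, 0) (0, 1) (velocityFst 𝔥 T.Ψ p) 0 0 :=
  HasTwoJet.comp_fst (u := fun s => T.Ψ s p.1 p.2) (T.contMDiff_Ψ_line p).contMDiffAt
    (T.Ψ_self _ _)

omit [LieGroup 𝓘(ℝ, 𝔤) ∞ G] in
/-- The two-jet of `(x', y') ↦ Φ(x; y', y)`. -/
theorem hasTwoJet_Φ (p : ℝ × ℝ) :
    HasTwoJet (fun q : ℝ × ℝ => T.Φ p.1 q.2 p.2) p (1, 0) (0, 1) 0 (velocitySnd 𝔥 T.Φ p) 0 :=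
  HasTwoJet.comp_snd (u := fun r => T.Φ p.1 r p.2) (T.contMDiff_Φ_line p).contMDiffAt
    (T.Φ_self _ _)

omit [LieGroup 𝓘(ℝ, 𝔤) ∞ G] in
theorem contDiff_velocityFst_Ψ : ContDiff ℝ ∞ (velocityFst 𝔥 T.Ψ) :=
  contDiff_velocityFst T.contMDiff_Ψ T.Ψ_self

omit [LieGroup 𝓘(ℝ, 𝔤) ∞ G] in
theorem contDiff_velocitySnd_Φ : ContDiff ℝ ∞ (velocitySnd 𝔥 T.Φ) :=
  contDiff_velocitySnd T.contMDiff_Φ T.Φ_self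

/-- Mixed component of the definition of `W*`: the derivatives of velocities come from `Ψ(x', x;
y')` and `Φ(x'; y', y)`, the action terms from `g⁻¹` and `f⁻¹`, and the bracket from the products of
`Φ` and `Ψ` factors. -/
theorem WMixed_transform (p : ℝ × ℝ) :
    T.transform.WMixed p = X.mdot (T.varkappa p)
      (C.WMixed p + fderiv ℝ (velocityFst 𝔥 T.Ψ) p (0, 1) -
        fderiv ℝ (velocitySnd 𝔥 T.Φ) p (1, 0) -
        X.actPairing (velocitySnd 𝔤 C.g p) (velocityFst 𝔥 T.Ψ p) +
        X.actPairing (velocityFst 𝔤 C.f p) (velocitySnd 𝔥 T.Φ p) -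
        bracket H (velocityFst 𝔥 T.Ψ p) (velocitySnd 𝔥 T.Φ p)) := by
  have h1 := T.hasTwoJet_Φ p
  have h2 := (C.hasTwoJet_g p).inv.act X (hasTwoJet_triple_fst T.contMDiff_Ψ T.Ψ_self p)
  have h4 := ((C.hasTwoJet_f p).inv.act X (hasTwoJet_triple_snd T.contMDiff_Φ T.Φ_self p)).inv
  have h5 := (T.hasTwoJet_Ψ p).inv
  have h := (((h1.mul h2).mul (C.hasTwoJet_W p)).mul h4).mul h5
  -- The velocities of the two `Φ` factors cancel, as do those of the two `Ψ` factors. This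
  -- vanishing is what allows `ṁ(ϰ)` to be applied to the mixed component.
  have hz : HasTwoJet (fun q : ℝ × ℝ => T.Φ p.1 q.2 p.2 *
      X.m (C.g p.1 q.2 p.2)⁻¹ (T.Ψ q.1 p.1 q.2) * C.W q.1 p.1 q.2 p.2 *
      (X.m (C.f q.1 p.1 p.2)⁻¹ (T.Φ q.1 q.2 p.2))⁻¹ * (T.Ψ q.1 p.1 p.2)⁻¹) p (1, 0) (0, 1) 0 0
      (C.WMixed p + fderiv ℝ (velocityFst 𝔥 T.Ψ) p (0, 1) -
        fderiv ℝ (velocitySnd 𝔥 T.Φ) p (1, 0) -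
        X.actPairing (velocitySnd 𝔤 C.g p) (velocityFst 𝔥 T.Ψ p) +
        X.actPairing (velocityFst 𝔤 C.f p) (velocitySnd 𝔥 T.Φ p) -
        bracket H (velocityFst 𝔥 T.Ψ p) (velocitySnd 𝔥 T.Φ p)) := by
    convert h using 1
    · simp
    · simp
    · rw [bracket_eq_mulPairing]
      simp
      abel
  exact ((T.transform.hasTwoJet_W p).unique (hz.mmap X (T.varkappa p))).2.2

/-- The derivative of a field of vectors `ṁ(ϰ) P`. -/
theorem hasFDerivAt_mdot_varkappa {P : ℝ × ℝ → 𝔥} (hP : ContDiff ℝ ∞ P) (p : ℝ × ℝ) :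
    HasFDerivAt (fun q => X.mdot (T.varkappa q) (P q))
      ((X.actPairing.comp (rightLog T.varkappa p)).flip (X.mdot (T.varkappa p) (P p)) +
        (X.mdot (T.varkappa p)).comp (fderiv ℝ P p)) p := by
  have hd := ((X.mdot (T.varkappa p)).hasFDerivAt.comp p
    (hP.contDiffAt.differentiableAt (x := p) (by simp)).hasFDerivAt)
  have h := X.hasFDerivAt_mdot_of_eq_one (T.contMDiff_varkappa_mul_inv p).contMDiffAt
    (mul_inv_cancel (T.varkappa p)) hd
  -- Splitting off `ϰ(p)` leaves an acting element with value 1 at `p`.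
  have e : (fun q => X.mdot (T.varkappa q) (P q)) = fun q =>
      X.mdot (T.varkappa q * (T.varkappa p)⁻¹) (X.mdot (T.varkappa p) (P q)) := by
    ext1 q
    rw [← X.mdot_mul, inv_mul_cancel_right]
  rw [e]
  exact h

/-- Brackets of `H` are written as `actPairing` after `tdot`, and equivariance moves `ṁ(ϰ)` outside
all pairings except those with `dϰ ϰ⁻¹`. These last ones occur in `dΓ` and in `m̂(a*, Γ)` with
opposite signs; the rest is linear algebra. -/
theorem B_transform [FiniteDimensional ℝ 𝔥] : T.transform.B =
    mapForm (fun p => X.mdot (T.varkappa p)) C.B - extDeriv T.Γ -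
      (1 / 2 : ℝ) • wedge (bracket H) T.Γ T.Γ - wedge X.mhat T.transform.a T.Γ := by
  refine Form.ext_two fun p => ?_
  have hx := (T.hasFDerivAt_mdot_varkappa T.contDiff_velocityFst_Ψ p).fun_neg
  have hy := (T.hasFDerivAt_mdot_varkappa T.contDiff_velocitySnd_Φ p).fun_neg
  have hd := extDeriv_oneForm_apply_basis hx.differentiableAt hy.differentiableAt
  rw [hx.fderiv, hy.fderiv] at hd
  have hanti : X.actPairing (X.tdot (velocitySnd 𝔥 T.Φ p)) (velocityFst 𝔥 T.Ψ p) =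
      -X.actPairing (X.tdot (velocityFst 𝔥 T.Ψ p)) (velocitySnd 𝔥 T.Φ p) := by
    simp only [X.actPairing_tdot, bracket_eq_mulPairing, neg_sub]
  rw [T.transform.B_eq, T.transform.a_eq, C.B_eq, T.Γ_eq]
  change twoForm (V := 𝔥) _ p ![(1, 0), (0, 1)] =
    mapForm (V := 𝔥) (W := 𝔥) _ _ p ![(1, 0), (0, 1)] -
    extDeriv (F := 𝔥) _ p ![(1, 0), (0, 1)] -
    (1 / 2 : ℝ) • wedge (V := 𝔥) (W := 𝔥) (U := 𝔥) _ _ _ p ![(1, 0), (0, 1)] -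
    wedge (V := 𝔤) (W := 𝔥) (U := 𝔥) _ _ _ p ![(1, 0), (0, 1)]
  simp only [hd, wedge_apply_basis, mapForm_apply, twoForm_apply_basis, oneForm_apply_fst,
    oneForm_apply_snd, T.WMixed_transform, T.velocityFst_transform_f, T.velocitySnd_transform_g,
    X.mhat_eq_actPairing, ← X.actPairing_tdot, map_add, map_sub, map_neg, add_apply, sub_apply,
    neg_apply, ContinuousLinearMap.flip_apply, ContinuousLinearMap.comp_apply,
    X.actPairing_Ad_mdot, ← X.Ad_tdot, hanti, neg_neg]
  module

end GaugeTransformation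

end GaugeForms

end HigherGauge

end

open HigherGauge in
theorem mainTheorem3 {𝔤 𝔥 G H : Type*}
    [NormedAddCommGroup 𝔤] [NormedSpace ℝ 𝔤] [FiniteDimensional ℝ 𝔤]
    [NormedAddCommGroup 𝔥] [NormedSpace ℝ 𝔥] [FiniteDimensional ℝ 𝔥]
    [TopologicalSpace G] [ChartedSpace 𝔤 G] [Group G] [LieGroup 𝓘(ℝ, 𝔤) ∞ G]
    [TopologicalSpace H] [ChartedSpace 𝔥 H] [Group H] [LieGroup 𝓘(ℝ, 𝔥) ∞ H]
    (X : LieCrossedModule 𝔤 𝔥 G H) (C : Cocycle X) (T : GaugeTransformation C) :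
    IsConnectionDoublet X T.transform.a T.transform.B ∧
    T.transform.a =
      mapForm (fun p => Ad (T.varkappa p)) C.a - toForm (rightLog T.varkappa) -
        mapForm (fun _ => X.tdot) T.Γ ∧
    T.transform.B =
      mapForm (fun p => X.mdot (T.varkappa p)) C.B - extDeriv T.Γ -
        (1 / 2 : ℝ) • wedge (bracket H) T.Γ T.Γ -
        wedge X.mhat
          (mapForm (fun p => Ad (T.varkappa p)) C.a - toForm (rightLog T.varkappa) -
            mapForm (fun _ => X.tdot) T.Γ)
          T.Γ := by
  -- `B_transform` has `a*` itself in the `m̂` term; the law for `a*` rewrites it into the stated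
  -- form.
  exact ⟨T.transform.isConnectionDoublet, T.a_transform, T.a_transform ▸ T.B_transform⟩
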